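/- **Setting.** Let $d\in\mathbb N$. On a probability space let ${\bf X}^{(1)},{\bf X}^{(2)},\dots$ be random vectors with common distribution $F$ supported on $[0,\infty)^d$. Let $\tau_i=\theta_1+\dots+\theta_i$, where $\theta_1,\theta_2,\dots\in[0,\infty)$ are i.i.d. Put $N(t)=\sup\{i\ge 1:\tau_i\le t\}$ (with $\sup\emptyset=0$) and assume that the renewal function $\lambda(t)=\mathbf E[N(t)]=\sum_{i\ge1}\mathbf P[\tau_i\le t]$ is finite for every $t\geq 0$; $\lambda(ds)$ denotes the measure on $[0,\infty)$ with $\lambda([0,t])=\lambda(t)$. Let $\{\xi(t),t\ge0\}$ be a real-valued measurable stochastic process such that for every finite $T$ with $\lambda(T)>0$ there is $K_T>0$ with $\mathbf P[\inf_{0\le t\le T}\xi(t)\ge -K_T]=1$. Assume that $\{{\bf X}^{(i)}\}$, $\{N(t)\}$ and $\{\xi(t)\}$ are mutually independent, in the sense that there is a $\sigma$-algebra $\mathcal G$ for which $(t,\omega)\mapsto\xi(t,\omega)$ is $\mathcal B([0,\infty))\otimes\mathcal G$-measurable and such that $\sigma({\bf X}^{(i)},i\ge1)$, $\sigma(N(t),t\ge0)$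 and $\mathcal G$ are mutually independent (if $\xi$ has right-continuous paths, this is ordinary mutual independence, with $\mathcal G=\sigma(\xi(t),t\ge0)$). Put $$\mathbf D(T)=\sum_{i=1}^{N(T)}{\bf X}^{(i)}e^{-\xi(\tau_i)} .$$ Let $A\subset\mathbb R^d$ be open and increasing (${\bf x}\in A$, ${\bf y}\in[0,\infty)^d$ imply ${\bf x}+{\bf y}\in A$), with $A^c$ convex and ${\bf 0}\notin\overline A$. Put $Y_A^{(i)}=\sup\{u>0:{\bf X}^{(i)}\in uA\}$ (with $\sup\emptyset=0$), let $F_A$ be the common distribution of these variables and $\overline{F_A}=1-F_A$. Assume: * the $Y_A^{(i)}$ are quasi-asymptotically independent: $\mathbf P[Y_A^{(i)}>x,\,Y_A^{(j)}>x]/\big(\mathbf P[Y_A^{(i)}>x]+\mathbf P[Y_A^{(j)}>x]\big)\to0$ as $x\to\infty$, for all $i\ne j$; * $F_A$ is consistently varying: $\overline{F_A}(x)>0$ for all $x$ and $\lim_{b\uparrow1}\limsup_{x\to\infty}\overline{F_A}(bx)/\overline{F_A}(x)=1$; * $F\in MRV(\alpha,\mu)$ with normalizing distribution $G$: here $0<\alpha<\infty$,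 $G$ is a distribution on $\mathbb R$ whose tail $\overline G=1-G$ is everywhere positive and satisfies $\overline G(yx)/\overline G(x)\to y^{-\alpha}$ as $x\to\infty$ for all $y>0$; $\mu$ is a nonzero measure on $[0,\infty)^d\setminus\{{\bf 0}\}$, finite on Borel sets bounded away from ${\bf 0}$ (and $\mu(A)$ means $\mu(A\cap[0,\infty)^d)$); and $\mathbf P[{\bf X}^{(1)}\in x\mathbb B]/\overline G(x)\to\mu(\mathbb B)$ as $x\to\infty$ for every Borel set $\mathbb B\subset[0,\infty)^d$ with ${\bf 0}\notin\overline{\mathbb B}$ whose boundary relative to $[0,\infty)^d$ is $\mu$-null. **Statement.** For every finite $T\geq 0$ with $\lambda(T)>0$: $\mu(A)<\infty$, $\mathbf E[e^{-\alpha\xi(s)}]<\infty$ for all $s\le T$, $s\mapsto\mathbf E[e^{-\alpha\xi(s)}]$ is $\lambda$-integrable on $[0,T]$ with $\int_0^T\mathbf E[e^{-\alpha\xi(s)}]\,\lambda(ds)>0$ (the integral being over $[0,T]$), and $$\lim_{x\to\infty}\frac{\mathbf P[\mathbf D(T)\in xA]}{\overline G(x)}=\mu(A)\int_0^T\mathbf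 E\big[e^{-\alpha\,\xi(s)}\big]\,\lambda(ds).$$ Consequently, if $\mu(A)>0$, $$\mathbf P[\mathbf D(T)\in xA]\sim\mu(A)\,\overline G(x)\int_0^T\mathbf E\big[e^{-\alpha\,\xi(s)}\big]\,\lambda(ds),\qquad x\to\infty .$$ -/

import Mathlib

open MeasureTheory ProbabilityTheory Filter Topology Set
open scoped NNReal ENNReal Pointwise

namespace RenewalRisk

noncomputable section

/-! ### Univariate distribution classes -/

/-- The tail `x ↦ 1 - G(x) = G((x, ∞))` of a distribution on the real line. -/
def tail (G : Measure ℝ) (x : ℝ) : ℝ := G.real (Ioi x)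

/-- The class of consistently varying distributions: the tail never vanishes and
`lim_{b ↑ 1} limsup_{x → ∞} tail (b x) / tail x = 1`. The upper limit is taken in `[0, ∞]`. -/
structure ConsistentlyVarying (G : Measure ℝ) : Prop where
  tail_pos : ∀ x, 0 < tail G x
  limit : Tendsto
    (fun b : ℝ => limsup (fun x : ℝ => ENNReal.ofReal (tail G (b * x) / tail G x)) atTop)
    (𝓝[<] 1) (𝓝 1)

/-- The class of distributions with regularly varying tail of index `-α`, `0 < α < ∞`. -/
structure RegularlyVarying (G : Measure ℝ) (α : ℝ) : Prop where
  index_pos : 0 < α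
  tail_pos : ∀ x, 0 < tail G x
  limit : ∀ y : ℝ, 0 < y → Tendsto (fun x : ℝ => tail G (y * x) / tail G x) atTop (𝓝 (y ^ (-α)))

/-! ### Multivariate notions

Vectors are elements of `Fin d → ℝ` with the componentwise order, so `Ici 0` is the closed
nonnegative orthant. -/

/-- Multivariate regular variation `F ∈ MRV(α, μ)` of a distribution `F` on the nonnegative
orthant, with normalizing univariate distribution `G`. The limit measure `μ` lives on the orthant
without the origin, is not zero, and is Radon there in the usual sense: the relatively compact
sets (of the compactified orthant without the origin) are those bounded away from the origin.
Convergence is required on the Borel sets bounded away from the origin whose boundary, relative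
to the orthant, is `μ`-null. -/
structure MRV {d : ℕ} (F : Measure (Fin d → ℝ)) (α : ℝ) (μ : Measure (Fin d → ℝ))
    (G : Measure ℝ) : Prop where
  regularlyVarying : RegularlyVarying G α
  concentrated : μ (Ici 0 \ {0})ᶜ = 0
  ne_zero : μ ≠ 0
  radon : ∀ B : Set (Fin d → ℝ), MeasurableSet B → (0 : Fin d → ℝ) ∉ closure B → μ B < ∞
  limit : ∀ B : Set (Fin d → ℝ), MeasurableSet B → B ⊆ Ici 0 → (0 : Fin d → ℝ) ∉ closure B →
    μ (closure B ∩ closure (Ici 0 \ B)) = 0 →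
    Tendsto (fun x : ℝ => F.real (x • B) / tail G x) atTop (𝓝 (μ.real B))

/-- The family of rare sets: open, increasing, with convex complement, and
with the origin outside the closure. -/
structure IsRareSet {d : ℕ} (A : Set (Fin d → ℝ)) : Prop where
  isOpen : IsOpen A
  increasing : ∀ x ∈ A, ∀ y : Fin d → ℝ, 0 ≤ y → x + y ∈ A
  convex_compl : Convex ℝ Aᶜ
  zero_notMem : (0 : Fin d → ℝ) ∉ closure A

/-- `z_A = sup {u > 0 : z ∈ u A}`, with `sup ∅ = 0`. -/
def scale {d : ℕ} (A : Set (Fin d → ℝ)) (z : Fin d → ℝ) : ℝ :=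
  sSup {u : ℝ | 0 < u ∧ z ∈ u • A}

/-- For a rare set, `z ↦ z_A` is measurable, so that the law of `Z_A` below is meaningful. -/
theorem measurable_scale {d : ℕ} {A : Set (Fin d → ℝ)} (hA : IsRareSet A) :
    Measurable (scale A) := by
  have hbdd : ∀ z : Fin d → ℝ, BddAbove {u : ℝ | 0 < u ∧ z ∈ u • A} := by
    intro z
    have h0 : Aᶜ ∈ 𝓝 (0 : Fin d → ℝ) :=
      mem_of_superset (isClosed_closure.isOpen_compl.mem_nhds hA.zero_notMem)
        (compl_subset_compl.2 subset_closure)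
    have ht : Tendsto (fun u : ℝ => u⁻¹ • z) atTop (𝓝 0) := by
      simpa using (tendsto_inv_atTop_zero (𝕜 := ℝ)).smul_const z
    obtain ⟨M, hM⟩ := eventually_atTop.1 (ht.eventually h0)
    refine ⟨M, fun u hu => ?_⟩
    by_contra! h
    exact hM u h.le ((mem_smul_set_iff_inv_smul_mem₀ hu.1.ne' A z).1 hu.2)
  refine measurable_of_Ioi fun x => ?_
  rcases lt_or_ge x 0 with hx | hx
  · have : scale A ⁻¹' Ioi x = univ :=
      eq_univ_of_forall fun z => hx.trans_le (Real.sSup_nonneg fun u hu => hu.1.le)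
    rw [this]
    exact MeasurableSet.univ
  · have : scale A ⁻¹' Ioi x = ⋃ u ∈ Ioi x, u • A := by
      ext z
      simp only [mem_preimage, mem_Ioi, mem_iUnion, exists_prop, scale]
      constructor
      · intro h
        have hne : {u : ℝ | 0 < u ∧ z ∈ u • A}.Nonempty := by
          by_contra hne
          rw [not_nonempty_iff_eq_empty.1 hne, Real.sSup_empty] at h
          exact absurd h (not_lt.2 hx)
        obtain ⟨u, hu, hxu⟩ := exists_lt_of_lt_csSup hne h
        exact ⟨u, hxu, hu.2⟩
      · rintro ⟨u, hxu, hu⟩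
        exact hxu.trans_le (le_csSup (hbdd z) ⟨hx.trans_lt hxu, hu⟩)
    rw [this]
    exact (isOpen_biUnion fun u hu =>
      hA.isOpen.smul₀ (hx.trans_lt (mem_Ioi.1 hu)).ne').measurableSet

/-- The distribution `F_A` of `Z_A = sup {u > 0 : Z ∈ u A}`, where `Z` has distribution `F`. -/
def lawOn {d : ℕ} (F : Measure (Fin d → ℝ)) (A : Set (Fin d → ℝ)) : Measure ℝ :=
  F.map (scale A)

section Model

variable {Ω : Type*} [mΩ : MeasurableSpace Ω]

/-- Quasi-asymptotic independence of a sequence of nonnegative random variables. -/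
def QAI (Z : ℕ → Ω → ℝ) (P : Measure Ω) : Prop :=
  ∀ i j : ℕ, i ≠ j → Tendsto
    (fun x : ℝ => P.real {ω | x < Z i ω ∧ x < Z j ω} /
      (P.real {ω | x < Z i ω} + P.real {ω | x < Z j ω})) atTop (𝓝 0)

/-- Quasi-asymptotic independence on `A` of a sequence of random vectors. -/
def QAIOn {d : ℕ} (A : Set (Fin d → ℝ)) (X : ℕ → Ω → Fin d → ℝ) (P : Measure Ω) : Prop :=
  QAI (fun i ω => scale A (X i ω)) P

/-! ### The renewal counting process

Sequences are indexed from `0`: `X i`, `θ i`, `arrivalTime θ i` are the `(i + 1)`-st claim vector,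
inter-arrival time and claim arrival time. -/

/-- The claim arrival times: partial sums of the inter-arrival times. -/
def arrivalTime (θ : ℕ → Ω → ℝ≥0) (i : ℕ) (ω : Ω) : ℝ≥0 := ∑ k ∈ Finset.range (i + 1), θ k ω

/-- The counting process `N(t) = sup {i ≥ 1 : τ_i ≤ t}`, with `sup ∅ = 0`. -/
def claimCount (θ : ℕ → Ω → ℝ≥0) (t : ℝ≥0) (ω : Ω) : ℕ∞ :=
  ⨆ i : ℕ, ⨆ _ : arrivalTime θ i ω ≤ t, ((i + 1 : ℕ) : ℕ∞)

/-- The renewal function `λ(t) = E[N(t)]`. -/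
def renewalFunction (θ : ℕ → Ω → ℝ≥0) (P : Measure Ω) (t : ℝ≥0) : ℝ≥0∞ :=
  ∫⁻ ω, (claimCount θ t ω : ℝ≥0∞) ∂P

/-- The measure `λ(ds)` on `[0, ∞)` with distribution function `λ`, namely the sum of the laws of
the arrival times. -/
def renewalMeasure (θ : ℕ → Ω → ℝ≥0) (P : Measure Ω) : Measure ℝ≥0 :=
  Measure.sum fun i => P.map (arrivalTime θ i)

/-- `λ([0, t]) = λ(t) = E[N(t)]`. -/
theorem renewalMeasure_Iic {θ : ℕ → Ω → ℝ≥0} (hθ : ∀ i, Measurable (θ i)) (P : Measure Ω)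
    (t : ℝ≥0) : renewalMeasure θ P (Iic t) = renewalFunction θ P t := by
  have hτ : ∀ i, Measurable (arrivalTime θ i) := fun i =>
    Finset.measurable_sum _ fun k _ => hθ k
  have hcount : ∀ ω, (claimCount θ t ω : ℝ≥0∞) =
      ∑' i, (arrivalTime θ i ⁻¹' Iic t).indicator (fun _ => (1 : ℝ≥0∞)) ω := by
    intro ω
    have hmono : Monotone fun i => arrivalTime θ i ω := fun i j hij =>
      Finset.sum_le_sum_of_subset (Finset.range_mono (by omega))
    by_cases hall : ∀ i, arrivalTime θ i ω ≤ t
    · have h1 : claimCount θ t ω = ⊤ := by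
        refine ENat.eq_top_iff_forall_ge.2 fun n => ?_
        refine le_trans ?_ (le_iSup₂_of_le n (hall n) le_rfl)
        exact_mod_cast Nat.le_succ n
      have h2 : ∀ i, (arrivalTime θ i ⁻¹' Iic t).indicator (fun _ => (1 : ℝ≥0∞)) ω = 1 :=
        fun i => indicator_of_mem (show ω ∈ arrivalTime θ i ⁻¹' Iic t from hall i) _
      simp [h1, h2]
    · push Not at hall
      classical
      have hlt : ∀ i, arrivalTime θ i ω ≤ t ↔ i < Nat.find hall := by
        intro i
        constructor
        · intro h
          by_contra! hle
          exact absurd ((hmono hle).trans h) (not_le.2 (Nat.find_spec hall))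
        · intro h
          exact not_lt.1 (Nat.find_min hall h)
      have h1 : claimCount θ t ω = (Nat.find hall : ℕ∞) := by
        apply le_antisymm
        · refine iSup₂_le fun i hi => ?_
          exact_mod_cast (hlt i).1 hi
        · rcases Nat.eq_zero_or_pos (Nat.find hall) with h0 | h0
          · rw [h0]; simp
          · refine le_iSup₂_of_le (Nat.find hall - 1) ((hlt _).2 (by omega)) ?_
            exact_mod_cast (by omega : Nat.find hall ≤ Nat.find hall - 1 + 1)
      rw [h1, tsum_eq_sum (s := Finset.range (Nat.find hall))]
      · rw [Finset.sum_congr rfl (g := fun _ => (1 : ℝ≥0∞)) fun i hi =>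
          indicator_of_mem (show ω ∈ arrivalTime θ i ⁻¹' Iic t from
            (hlt i).2 (Finset.mem_range.1 hi)) _]
        simp
      · intro i hi
        exact indicator_of_notMem (s := arrivalTime θ i ⁻¹' Iic t)
          (fun h => hi (Finset.mem_range.2 ((hlt i).1 h))) _
  unfold renewalFunction renewalMeasure
  simp_rw [hcount]
  rw [lintegral_tsum fun i =>
      (measurable_const.indicator (hτ i measurableSet_Iic)).aemeasurable,
    Measure.sum_apply _ measurableSet_Iic]
  refine tsum_congr fun i => ?_
  rw [Measure.map_apply (hτ i) measurableSet_Iic,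
    lintegral_indicator (hτ i measurableSet_Iic)]
  simp

/-- The inter-arrival times are independent and identically distributed, and the renewal function
is finite. -/
structure IsRenewal (θ : ℕ → Ω → ℝ≥0) (P : Measure Ω) : Prop where
  measurable : ∀ i, Measurable (θ i)
  indep : iIndepFun θ P
  identDistrib : ∀ i, IdentDistrib (θ i) (θ 0) P P
  finite : ∀ t, renewalFunction θ P t < ∞

/-! ### The claims and the investment process -/

/-- The claim vectors are random vectors with common distribution `F`, supported by the
nonnegative orthant. -/
structure IsClaimSequence {d : ℕ} (X : ℕ → Ω → Fin d → ℝ) (F : Measure (Fin d → ℝ))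
    (P : Measure Ω) : Prop where
  measurable : ∀ i, Measurable (X i)
  law : ∀ i, P.map (X i) = F
  nonneg : F (Ici 0)ᶜ = 0

/-- Mutual independence of the claim vectors `{X i}`, of the counting process `{N(t)}` and of the
process `{ξ(t)}`, the latter being a measurable process. The values of `ξ` at the (random) arrival
times enter the model, so the information carried by `ξ` is a σ-algebra `𝓖` for which
`(t, ω) ↦ ξ(t, ω)` is jointly measurable; if the paths of `ξ` are right-continuous, then `𝓖` can
be taken to be the σ-algebra generated by the variables `ξ(t)`. -/
def MutuallyIndependent {d : ℕ} (X : ℕ → Ω → Fin d → ℝ) (θ : ℕ → Ω → ℝ≥0) (ξ : ℝ≥0 → Ω → ℝ)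
    (P : Measure Ω) : Prop :=
  ∃ 𝓖 : MeasurableSpace Ω, 𝓖 ≤ mΩ ∧
    @Measurable (ℝ≥0 × Ω) ℝ (@Prod.instMeasurableSpace ℝ≥0 Ω _ 𝓖) _ (fun p => ξ p.1 p.2) ∧
    iIndep ![⨆ i, MeasurableSpace.comap (X i) inferInstance,
      ⨆ t, MeasurableSpace.comap (claimCount θ t) inferInstance, 𝓖] P

/-- The process `ξ` is bounded away from `-∞`: for each finite `T` with `λ(T) > 0` there is a
positive constant `K` with `P[inf_{0 ≤ t ≤ T} ξ(t) ≥ -K] = 1`. -/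
def BoundedBelow (ξ : ℝ≥0 → Ω → ℝ) (θ : ℕ → Ω → ℝ≥0) (P : Measure Ω) : Prop :=
  ∀ T : ℝ≥0, 0 < renewalFunction θ P T →
    ∃ K : ℝ, 0 < K ∧ ∀ᵐ ω ∂P, ∀ t : ℝ≥0, t ≤ T → -K ≤ ξ t ω

/-- The discounted aggregate claims `D(T) = ∑_{i = 1}^{N(T)} X^{(i)} e^{-ξ(τ_i)}`. (`N(T)` is almost
surely finite when the renewal function is.) -/
def discountedClaims {d : ℕ} (X : ℕ → Ω → Fin d → ℝ) (θ : ℕ → Ω → ℝ≥0) (ξ : ℝ≥0 → Ω → ℝ)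
    (T : ℝ≥0) (ω : Ω) : Fin d → ℝ :=
  ∑ i ∈ Finset.range (claimCount θ T ω).toNat,
    Real.exp (-ξ (arrivalTime θ i ω) ω) • X i ω

end Model

end

end RenewalRisk

/-! The proof reduces the vector problem to one dimension and then uses the principle of a single
big jump. For a rare set, `scale A` behaves like a gauge: `x < scale A z` iff `z ∈ x • A` for `x >
0`, it is positively homogeneous, and convexity of the complement makes it subadditive. For
nonnegative weights `w i` and claims `X i`, the event `∑ w i • X i ∈ x • A` therefore contains, up
to a null set, the event that some `w i * Y i` exceeds `x` (`A` is increasing), and is contained in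
the event that `∑ w i * Y i` exceeds `x`, where `Y i = scale A (X i)`.

`MRV.tendsto_measureReal_smul` gives `Y i` a tail asymptotic to `μ A` times that of `G`. For fixed
weights, quasi-asymptotic independence makes two simultaneous large terms negligible, so both bounds
are asymptotic to `μ A * ∑ w i ^ α` times the tail of `G` (`RegularlyVarying.tendsto_weightedSum`).

Independence allows the number of claims and the discount factors to be frozen while the claims are
integrated out. The limit passes through the remaining expectation by dominated convergence: on `[0,
T]` the factors are at most `e ^ K`, a Potter-type bound (`RegularlyVarying.exists_dominated`) shows
that `n` terms cost at most a power of `n`, and `N(T)` has all moments. The resulting expectation of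
`∑ e ^ (-α ξ(τ_i))` over arrivals up to `T` is the integral against the renewal measure
(`integral_sum_discountFactor_rpow`). -/

namespace RenewalRisk

/-! ### Geometry of rare sets -/

section RareSet

variable {d : ℕ} {A : Set (Fin d → ℝ)}

theorem IsRareSet.compl_mem_nhds_zero (hA : IsRareSet A) : Aᶜ ∈ 𝓝 (0 : Fin d → ℝ) :=
  mem_of_superset (isClosed_closure.isOpen_compl.mem_nhds hA.zero_notMem)
    (compl_subset_compl.2 subset_closure)

theorem IsRareSet.zero_mem_compl (hA : IsRareSet A) : (0 : Fin d → ℝ) ∈ Aᶜ :=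
  mem_of_mem_nhds hA.compl_mem_nhds_zero

/-- The point `z` lies on the segment from `0` to `u • z`; if the far end were in the convex
complement, so would be `z`. -/
theorem IsRareSet.smul_mem (hA : IsRareSet A) {u : ℝ} (hu : 1 ≤ u) {z : Fin d → ℝ} (hz : z ∈ A) :
    u • z ∈ A := by
  by_contra h
  have hu0 : 0 < u := by linarith
  have := hA.convex_compl h hA.zero_mem_compl (a := u⁻¹) (b := 1 - u⁻¹) (by positivity)
    (sub_nonneg.2 (inv_le_one_of_one_le₀ hu)) (by ring)
  rw [smul_zero, add_zero, smul_smul, inv_mul_cancel₀ hu0.ne', one_smul] at this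
  exact this hz

theorem IsRareSet.smul_subset_smul (hA : IsRareSet A) {u v : ℝ} (hu : 0 < u) (huv : u ≤ v) :
    v • A ⊆ u • A := by
  rintro _ ⟨z, hz, rfl⟩
  refine ⟨(u⁻¹ * v) • z, hA.smul_mem ?_ hz, ?_⟩
  · rw [inv_mul_eq_div, one_le_div hu]; exact huv
  · simp only [smul_smul]
    rw [mul_inv_cancel_left₀ hu.ne']

theorem IsRareSet.smul_subset (hA : IsRareSet A) {u : ℝ} (hu : 1 ≤ u) : u • A ⊆ A := by
  simpa using hA.smul_subset_smul one_pos hu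

theorem IsRareSet.bddAbove (hA : IsRareSet A) (z : Fin d → ℝ) :
    BddAbove {u : ℝ | 0 < u ∧ z ∈ u • A} := by
  have ht : Tendsto (fun u : ℝ => u⁻¹ • z) atTop (𝓝 0) := by
    simpa using (tendsto_inv_atTop_zero (𝕜 := ℝ)).smul_const z
  obtain ⟨M, hM⟩ := eventually_atTop.1 (ht.eventually hA.compl_mem_nhds_zero)
  refine ⟨M, fun u hu => ?_⟩
  by_contra! h
  exact hM u h.le ((mem_smul_set_iff_inv_smul_mem₀ hu.1.ne' A z).1 hu.2)

theorem IsRareSet.exists_one_lt_mem_smul (hA : IsRareSet A) {z : Fin d → ℝ} (hz : z ∈ A) :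
    ∃ v : ℝ, 1 < v ∧ z ∈ v • A := by
  have ht : Tendsto (fun u : ℝ => u⁻¹ • z) (𝓝[>] 1) (𝓝 z) := by
    have : ContinuousAt (fun u : ℝ => u⁻¹ • z) 1 :=
      (continuousAt_inv₀ one_ne_zero).smul continuousAt_const
    simpa [ContinuousAt] using this.tendsto.mono_left nhdsWithin_le_nhds
  obtain ⟨v, hv, hv1⟩ := ((ht.eventually (hA.isOpen.mem_nhds hz)).and
    self_mem_nhdsWithin).exists
  have hv0 : (0 : ℝ) < v := one_pos.trans hv1
  exact ⟨v, hv1, (mem_smul_set_iff_inv_smul_mem₀ hv0.ne' A z).2 hv⟩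

/-- Openness of `A` means that the supremum is never attained, which is why the inequality is
strict. -/
theorem IsRareSet.lt_scale_iff (hA : IsRareSet A) {x : ℝ} (hx : 0 < x) {z : Fin d → ℝ} :
    x < scale A z ↔ z ∈ x • A := by
  constructor
  · intro h
    have hne : {u : ℝ | 0 < u ∧ z ∈ u • A}.Nonempty := by
      by_contra hne
      rw [scale, not_nonempty_iff_eq_empty.1 hne, Real.sSup_empty] at h
      exact absurd h (not_lt.2 hx.le)
    obtain ⟨u, hu, hxu⟩ := exists_lt_of_lt_csSup hne h
    exact hA.smul_subset_smul hx hxu.le hu.2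
  · intro h
    obtain ⟨v, hv1, hv⟩ := hA.exists_one_lt_mem_smul
      ((mem_smul_set_iff_inv_smul_mem₀ hx.ne' A z).1 h)
    have hxv : z ∈ (x * v) • A := by
      rw [← smul_smul]; exact (mem_smul_set_iff_inv_smul_mem₀ hx.ne' _ z).2 hv
    exact (lt_mul_of_one_lt_right hx hv1).trans_le
      (le_csSup (hA.bddAbove z) ⟨mul_pos hx (one_pos.trans hv1), hxv⟩)

theorem scale_nonneg (A : Set (Fin d → ℝ)) (z : Fin d → ℝ) : 0 ≤ scale A z :=
  Real.sSup_nonneg fun _ hu => hu.1.le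

theorem IsRareSet.scale_le_of_forall (hA : IsRareSet A) {z : Fin d → ℝ} {b : ℝ} (hb : 0 ≤ b)
    (h : ∀ x, b < x → z ∉ x • A) : scale A z ≤ b := by
  refine le_of_forall_gt_imp_ge_of_dense fun x hx => ?_
  exact not_lt.1 fun hlt => h x hx ((hA.lt_scale_iff (hb.trans_lt hx)).1 hlt)

theorem IsRareSet.scale_zero (hA : IsRareSet A) : scale A 0 = 0 := by
  refine le_antisymm (hA.scale_le_of_forall le_rfl fun x hx h => ?_) (scale_nonneg A 0)
  have := (mem_smul_set_iff_inv_smul_mem₀ hx.ne' A 0).1 h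
  rw [smul_zero] at this
  exact hA.zero_mem_compl this

theorem IsRareSet.scale_smul_le (hA : IsRareSet A) {w : ℝ} (hw : 0 < w) (z : Fin d → ℝ) :
    scale A (w • z) ≤ w * scale A z := by
  refine hA.scale_le_of_forall (mul_nonneg hw.le (scale_nonneg A z)) fun x hx h => ?_
  have hx0 : 0 < x := (mul_nonneg hw.le (scale_nonneg A z)).trans_lt hx
  have hz : z ∈ (w⁻¹ * x) • A := by
    rw [← smul_smul, mem_smul_set_iff_inv_smul_mem₀ (inv_ne_zero hw.ne'), inv_inv]
    exact h
  have := (hA.lt_scale_iff (by positivity)).2 hz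
  rw [inv_mul_lt_iff₀ hw] at this
  exact absurd hx this.not_gt

theorem IsRareSet.scale_smul (hA : IsRareSet A) {w : ℝ} (hw : 0 ≤ w) (z : Fin d → ℝ) :
    scale A (w • z) = w * scale A z := by
  rcases hw.eq_or_lt with rfl | hw
  · simp [hA.scale_zero]
  refine le_antisymm (hA.scale_smul_le hw z) ?_
  have := hA.scale_smul_le (inv_pos.2 hw) (w • z)
  rwa [smul_smul, inv_mul_cancel₀ hw.ne', one_smul, le_inv_mul_iff₀ hw] at this

theorem IsRareSet.scale_add_le (hA : IsRareSet A) (y z : Fin d → ℝ) :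
    scale A (y + z) ≤ scale A y + scale A z := by
  have hy := scale_nonneg A y
  have hz := scale_nonneg A z
  refine hA.scale_le_of_forall (add_nonneg hy hz) fun x hx h => ?_
  -- Sharing the slack equally puts `a` and `b` strictly above the two scales, hence both are
  -- positive even when a scale vanishes. Then `x⁻¹ • (y + z)` is the convex combination of `a⁻¹ •
  -- y` and `b⁻¹ • z` with weights `a / x` and `b / x`.
  set a := scale A y + (x - (scale A y + scale A z)) / 2 with ha
  set b := scale A z + (x - (scale A y + scale A z)) / 2 with hb
  have ha0 : 0 < a := by rw [ha]; linarith
  have hb0 : 0 < b := by rw [hb]; linarith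
  have hab : a + b = x := by rw [ha, hb]; ring
  have hya : a⁻¹ • y ∈ Aᶜ := fun hmem => by
    have := (hA.lt_scale_iff ha0).2 ((mem_smul_set_iff_inv_smul_mem₀ ha0.ne' A y).2 hmem)
    rw [ha] at this; linarith
  have hzb : b⁻¹ • z ∈ Aᶜ := fun hmem => by
    have := (hA.lt_scale_iff hb0).2 ((mem_smul_set_iff_inv_smul_mem₀ hb0.ne' A z).2 hmem)
    rw [hb] at this; linarith
  have hx0 : 0 < x := by linarith
  have := hA.convex_compl hya hzb (a := a / x) (b := b / x) (by positivity) (by positivity)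
    (by rw [← add_div, hab, div_self hx0.ne'])
  rw [smul_smul, smul_smul, div_mul_eq_mul_div, mul_inv_cancel₀ ha0.ne', div_mul_eq_mul_div,
    mul_inv_cancel₀ hb0.ne', one_div, ← smul_add] at this
  exact this ((mem_smul_set_iff_inv_smul_mem₀ hx0.ne' A _).1 h)

theorem IsRareSet.scale_sum_le (hA : IsRareSet A) {ι : Type*} (s : Finset ι) {w : ι → ℝ}
    (hw : ∀ i, 0 ≤ w i) (z : ι → Fin d → ℝ) :
    scale A (∑ i ∈ s, w i • z i) ≤ ∑ i ∈ s, w i * scale A (z i) := by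
  classical
  induction s using Finset.induction_on with
  | empty => simp [hA.scale_zero]
  | insert a s ha ih =>
    rw [Finset.sum_insert ha, Finset.sum_insert ha, ← hA.scale_smul (hw a)]
    exact (hA.scale_add_le _ _).trans (by gcongr)

theorem IsRareSet.mem_smul_of_le (hA : IsRareSet A) {x : ℝ} (hx : 0 < x) {y z : Fin d → ℝ}
    (hy : y ∈ x • A) (hyz : y ≤ z) : z ∈ x • A := by
  rw [mem_smul_set_iff_inv_smul_mem₀ hx.ne'] at hy ⊢
  have := hA.increasing _ hy (x⁻¹ • (z - y)) (smul_nonneg (by positivity) (sub_nonneg.2 hyz))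
  rwa [← smul_add, add_sub_cancel] at this

/-- The origin is interior to the convex set `Aᶜ`, so a boundary point of `A` moved strictly towards
the origin becomes interior to `Aᶜ` and leaves `closure A`. -/
theorem IsRareSet.disjoint_smul_frontier (hA : IsRareSet A) {u v : ℝ} (hu : 0 < u) (huv : u < v) :
    Disjoint (u • (closure A \ A)) (v • (closure A \ A)) := by
  have hv : 0 < v := hu.trans huv
  refine Set.disjoint_left.2 ?_
  rintro _ ⟨a, ha, rfl⟩ ⟨b, hb, hab⟩
  have hba : (u / v) • a + (1 - u / v) • (0 : Fin d → ℝ) = b := by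
    rw [smul_zero, add_zero, div_eq_inv_mul, ← smul_smul]
    have : v • b = u • a := hab
    rw [← this, smul_smul, inv_mul_cancel₀ hv.ne', one_smul]
  have := hA.convex_compl.combo_self_interior_mem_interior ha.2
    (mem_interior_iff_mem_nhds.2 hA.compl_mem_nhds_zero) (a := u / v) (b := 1 - u / v)
    (by positivity) (sub_pos.2 ((div_lt_one hv).2 huv)) (by ring)
  rw [hba, interior_compl] at this
  exact this hb.1

theorem IsRareSet.smul_closure_subset (hA : IsRareSet A) {u : ℝ} (hu : 1 ≤ u) :
    u • closure A ⊆ closure A := by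
  rw [← closure_smul₀' (by positivity : u ≠ 0)]
  exact closure_mono (hA.smul_subset hu)

/-- The dilates with `u ≥ 1` are disjoint and lie in `closure A`, which has finite measure, so only
countably many of them can be charged. -/
theorem IsRareSet.exists_null_smul_frontier (hA : IsRareSet A) {μ : Measure (Fin d → ℝ)}
    (hμ : μ (closure A) < ∞) {b : ℝ} (hb : 1 < b) :
    ∃ u : ℝ, 1 < u ∧ u < b ∧ μ (u • (closure A \ A)) = 0 := by
  have : IsFiniteMeasure (μ.restrict (closure A)) := ⟨by simpa using hμ⟩
  have hmeas : ∀ u : Ici (1 : ℝ), MeasurableSet ((u : ℝ) • (closure A \ A)) := fun u =>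
    (isClosed_closure.measurableSet.diff hA.isOpen.measurableSet).const_smul₀ _
  have hcount := Measure.countable_meas_pos_of_disjoint_iUnion (μ := μ.restrict (closure A))
    (As := fun u : Ici (1 : ℝ) => (u : ℝ) • (closure A \ A)) hmeas (by
      intro u v huv
      have hu0 : (0 : ℝ) < u := one_pos.trans_le u.2
      have hv0 : (0 : ℝ) < v := one_pos.trans_le v.2
      rcases lt_or_gt_of_ne (fun h => huv (Subtype.ext h) : (u : ℝ) ≠ v) with h | h
      · exact hA.disjoint_smul_frontier hu0 h
      · exact (hA.disjoint_smul_frontier hv0 h).symm)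
  obtain ⟨u, hu, hu'⟩ := ((hcount.image Subtype.val).dense_compl ℝ).exists_mem_open
    (isOpen_Ioo (a := (1 : ℝ)) (b := b)) (nonempty_Ioo.2 hb)
  refine ⟨u, hu'.1, hu'.2, ?_⟩
  by_contra hne
  refine hu ⟨⟨u, hu'.1.le⟩, ?_, rfl⟩
  have hsub : u • (closure A \ A) ⊆ closure A :=
    (smul_set_mono sdiff_subset).trans (hA.smul_closure_subset hu'.1.le)
  have := Measure.restrict_eq_self μ hsub
  exact (pos_iff_ne_zero.2 hne).trans_eq this.symm

end RareSet

/-! ### Tails -/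

theorem tail_nonneg (G : Measure ℝ) (x : ℝ) : 0 ≤ tail G x := measureReal_nonneg

theorem tail_antitone (G : Measure ℝ) [IsFiniteMeasure G] : Antitone (tail G) := fun _ _ h =>
  measureReal_mono (Ioi_subset_Ioi h)

theorem tail_le_one (G : Measure ℝ) [IsProbabilityMeasure G] (x : ℝ) : tail G x ≤ 1 :=
  measureReal_le_one

theorem tail_lawOn {d : ℕ} {A : Set (Fin d → ℝ)} (hA : IsRareSet A) (F : Measure (Fin d → ℝ))
    {x : ℝ} (hx : 0 < x) : tail (lawOn F A) x = F.real (x • A) := by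
  rw [tail, lawOn, map_measureReal_apply (measurable_scale hA) measurableSet_Ioi]
  congr 1
  ext z
  exact hA.lt_scale_iff hx

/-! ### The limit of the normalized probability of a dilated rare set -/

section MRV

variable {d : ℕ} {F μ : Measure (Fin d → ℝ)} {A : Set (Fin d → ℝ)} {α : ℝ} {G : Measure ℝ}

theorem MRV.measure_closure_lt_top (h : MRV F α μ G) (hA : IsRareSet A) : μ (closure A) < ∞ :=
  h.radon _ isClosed_closure.measurableSet (by simpa using hA.zero_notMem)

theorem MRV.measure_lt_top (h : MRV F α μ G) (hA : IsRareSet A) : μ A < ∞ :=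
  (measure_mono subset_closure).trans_lt (h.measure_closure_lt_top hA)

theorem measureReal_inter_of_compl_null {E : Type*} [MeasurableSpace E] {ν : Measure E}
    {S : Set E} (hS : ν Sᶜ = 0) (B : Set E) : ν.real (B ∩ S) = ν.real B := by
  refine measureReal_congr (Eventually.of_forall (p := fun _ => True) (fun _ => trivial)
    |>.and (mem_ae_iff.2 hS) |>.mono fun z hz => ?_)
  exact propext (and_iff_left hz.2)

/-- Since `x • A = (u⁻¹ * x) • (u • A)`, the limit for `u • A` transfers to `A`, and regular
variation of `G` supplies the factor `u ^ α`. The boundary of `A` itself need not be null. -/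
theorem MRV.tendsto_of_null_frontier (h : MRV F α μ G) (hF : F (Ici 0)ᶜ = 0) (hA : IsRareSet A)
    {u : ℝ} (hu : 1 ≤ u) (hnull : μ (u • (closure A \ A)) = 0) :
    Tendsto (fun x : ℝ => F.real (x • A) / tail G x) atTop (𝓝 (μ.real (u • A) * u ^ α)) := by
  have hu0 : 0 < u := by positivity
  have hopen : IsOpen (u • A) := hA.isOpen.smul₀ hu0.ne'
  have hμ : μ (Ici 0)ᶜ = 0 :=
    measure_mono_null (compl_subset_compl.2 sdiff_subset) h.concentrated
  have hcl : closure (u • A ∩ Ici 0) ⊆ closure A :=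
    closure_mono (inter_subset_left.trans (hA.smul_subset hu))
  have hlim := h.limit (u • A ∩ Ici 0) (hopen.measurableSet.inter measurableSet_Ici)
    inter_subset_right (fun h0 => hA.zero_notMem (hcl h0)) (measure_mono_null ?_ hnull)
  · rw [measureReal_inter_of_compl_null hμ] at hlim
    have hx : Tendsto (fun x : ℝ => u⁻¹ * x) atTop atTop :=
      tendsto_id.const_mul_atTop (inv_pos.2 hu0)
    have hrv := h.regularlyVarying.limit u⁻¹ (inv_pos.2 hu0)
    rw [Real.inv_rpow hu0.le, Real.rpow_neg hu0.le, inv_inv] at hrv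
    refine ((hlim.comp hx).mul hrv).congr' ?_
    filter_upwards [eventually_gt_atTop 0] with x hx0
    have hs : F.real ((u⁻¹ * x) • (u • A ∩ Ici 0)) = F.real (x • A) := by
      rw [smul_set_inter₀ (by positivity), smul_smul, mul_assoc, mul_comm x, ← mul_assoc,
        inv_mul_cancel₀ hu0.ne', one_mul]
      have : (u⁻¹ * x) • Ici (0 : Fin d → ℝ) = Ici 0 := by
        ext z
        have hpos : 0 < (u⁻¹ * x)⁻¹ := by positivity
        rw [mem_smul_set_iff_inv_smul_mem₀ (by positivity), mem_Ici, mem_Ici]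
        refine ⟨fun hz => ?_, smul_nonneg hpos.le⟩
        simpa only [smul_smul, inv_mul_cancel₀ hpos.ne', one_smul] using
          smul_nonneg (inv_pos.2 hpos).le hz
      rw [this, measureReal_inter_of_compl_null hF]
    simp only [Function.comp_apply]
    rw [hs, div_mul_div_cancel₀ (h.regularlyVarying.tail_pos _).ne']
  -- As `u • A` is open, the closure of its relative complement misses it, so the relative boundary
  -- is contained in `u • (closure A \ A)`.
  · rw [smul_set_sdiff₀ hu0.ne', ← closure_smul₀' hu0.ne']
    refine fun z hz => ⟨closure_mono inter_subset_left hz.1, ?_⟩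
    exact closure_minimal (fun y hy hyA => hy.2 ⟨hyA, hy.1⟩) hopen.isClosed_compl hz.2

/-- The limit along `x` does not depend on the admissible dilation `u`. As `u` decreases to `1`, the
sets `u • A` exhaust the open set `A`, which identifies that limit as `μ A` without homogeneity of
`μ`. -/
theorem MRV.tendsto_measureReal_smul (h : MRV F α μ G) (hF : F (Ici 0)ᶜ = 0) (hA : IsRareSet A) :
    Tendsto (fun x : ℝ => F.real (x • A) / tail G x) atTop (𝓝 (μ.real A)) := by
  have hfin := h.measure_lt_top hA
  obtain ⟨v, hvanti, hv1, hvlim⟩ := exists_seq_strictAnti_tendsto (1 : ℝ)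
  choose u hu1 huv hnull using fun n =>
    hA.exists_null_smul_frontier (h.measure_closure_lt_top hA) (hv1 n)
  have hlim := fun n => h.tendsto_of_null_frontier hF hA (hu1 n).le (hnull n)
  have hulim : Tendsto u atTop (𝓝 1) :=
    tendsto_of_tendsto_of_tendsto_of_le_of_le tendsto_const_nhds hvlim (fun n => (hu1 n).le)
      fun n => (huv n).le
  have hmono : Monotone fun n => v n • A := fun m n hmn =>
    hA.smul_subset_smul (one_pos.trans (hv1 n)) (hvanti.antitone hmn)
  have hunion : ⋃ n, v n • A = A := by
    refine Subset.antisymm (iUnion_subset fun n => hA.smul_subset (hv1 n).le) fun z hz => ?_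
    obtain ⟨r, hr1, hr⟩ := hA.exists_one_lt_mem_smul hz
    obtain ⟨n, hn⟩ := (hvlim.eventually (gt_mem_nhds hr1)).exists
    exact mem_iUnion.2 ⟨n, hA.smul_subset_smul (one_pos.trans (hv1 n)) hn.le hr⟩
  have hvmeas : Tendsto (fun n => μ.real (v n • A)) atTop (𝓝 (μ.real A)) := by
    have := tendsto_measure_iUnion_atTop (μ := μ) hmono
    rw [hunion] at this
    exact (ENNReal.tendsto_toReal hfin.ne).comp this
  have humeas : Tendsto (fun n => μ.real (u n • A)) atTop (𝓝 (μ.real A)) := by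
    refine tendsto_of_tendsto_of_tendsto_of_le_of_le hvmeas tendsto_const_nhds (fun n => ?_)
      fun n => ?_
    · exact measureReal_mono (hA.smul_subset_smul (one_pos.trans (hu1 n)) (huv n).le)
        (measure_mono (hA.smul_subset (hu1 n).le) |>.trans_lt hfin).ne
    · exact measureReal_mono (hA.smul_subset (hu1 n).le) hfin.ne
  have hconst : Tendsto (fun n => μ.real (u n • A) * u n ^ α) atTop (𝓝 (μ.real A)) := by
    simpa using humeas.mul (hulim.rpow_const (p := α) (Or.inl one_ne_zero))
  have heq : ∀ n, μ.real (u n • A) * u n ^ α = μ.real (u 0 • A) * u 0 ^ α := fun n =>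
    tendsto_nhds_unique (hlim n) (hlim 0)
  simp_rw [heq] at hconst
  rw [tendsto_nhds_unique hconst tendsto_const_nhds]
  exact hlim 0

end MRV

/-! ### Weighted sums of quasi-asymptotically independent variables -/

/-- A Potter-type bound, obtained by repeated halving: since `m > α`, each halving of the argument
costs at most a factor `2 ^ m` once the argument is large. -/
theorem RegularlyVarying.exists_dominated {G : Measure ℝ} [IsFiniteMeasure G] {α : ℝ}
    (hG : RegularlyVarying G α) {h : ℝ → ℝ} (hanti : Antitone h) (hle : ∀ x, h x ≤ 1) {c : ℝ}
    (hlim : Tendsto (fun x => h x / tail G x) atTop (𝓝 c)) :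
    ∃ (C x₀ : ℝ) (m : ℕ), 0 < C ∧ 0 < x₀ ∧ ∀ x, x₀ ≤ x → ∀ R : ℕ, R ≠ 0 →
      h (x / R) ≤ C * (2 * R) ^ m * tail G x := by
  obtain ⟨m, hm⟩ := exists_nat_gt α
  have hB : (2⁻¹ : ℝ) ^ (-α) < 2 ^ m := by
    rw [Real.inv_rpow two_pos.le, Real.rpow_neg two_pos.le, inv_inv, ← Real.rpow_natCast]
    exact Real.rpow_lt_rpow_of_exponent_lt one_lt_two hm
  obtain ⟨x₁, hx₁⟩ := eventually_atTop.1
    (((hG.limit 2⁻¹ (by norm_num)).eventually (gt_mem_nhds hB)).and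
      ((hlim.eventually (gt_mem_nhds (lt_add_one c))).and (eventually_gt_atTop 0)))
  have hx₁0 : 0 < x₁ := (hx₁ x₁ le_rfl).2.2
  -- The first entry starts the induction at `k = 0`. The second handles `x < 2 * x₁`, where halving
  -- leaves the asymptotic range: there `C * tail G x ≥ 1`, and `h ≤ 1` suffices.
  set C := max (c + 1) (tail G (2 * x₁))⁻¹ with hC
  have hC0 : 0 < C := lt_max_of_lt_right (inv_pos.2 (hG.tail_pos _))
  have key : ∀ k : ℕ, ∀ x, x₁ ≤ x → h (x / 2 ^ k) ≤ C * (2 ^ m) ^ k * tail G x := by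
    intro k
    induction k with
    | zero =>
      intro x hx
      have := ((div_lt_iff₀ (hG.tail_pos x)).1 (hx₁ x hx).2.1).le
      rw [pow_zero, pow_zero, div_one, mul_one]
      exact this.trans (mul_le_mul_of_nonneg_right (le_max_left _ _) (tail_nonneg G x))
    | succ k ih =>
      intro x hx
      have hx0 : 0 < x := hx₁0.trans_le hx
      have hsplit : x / 2 ^ (k + 1) = 2⁻¹ * x / 2 ^ k := by rw [pow_succ]; field_simp
      rcases le_or_gt x₁ (2⁻¹ * x) with hx' | hx'
      · rw [hsplit]
        refine (ih _ hx').trans ?_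
        have := ((div_lt_iff₀ (hG.tail_pos x)).1 (hx₁ x hx).1).le
        calc C * (2 ^ m) ^ k * tail G (2⁻¹ * x) ≤ C * (2 ^ m) ^ k * (2 ^ m * tail G x) := by gcongr
          _ = C * (2 ^ m) ^ (k + 1) * tail G x := by ring
      · have h1 : 1 ≤ C * tail G x := by
          have h2 : tail G (2 * x₁) ≤ tail G x := tail_antitone G (by linarith)
          calc 1 = (tail G (2 * x₁))⁻¹ * tail G (2 * x₁) :=
                (inv_mul_cancel₀ (hG.tail_pos _).ne').symm
            _ ≤ C * tail G x := mul_le_mul (le_max_right _ _) h2 (tail_nonneg _ _) hC0.le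
        have h3 : (1 : ℝ) ≤ (2 ^ m) ^ (k + 1) := one_le_pow₀ (one_le_pow₀ one_le_two)
        calc h (x / 2 ^ (k + 1)) ≤ 1 * 1 := (hle _).trans_eq (one_mul 1).symm
          _ ≤ (2 ^ m) ^ (k + 1) * (C * tail G x) := by gcongr
          _ = C * (2 ^ m) ^ (k + 1) * tail G x := by ring
  refine ⟨C, x₁, m, hC0, hx₁0, fun x hx R hR => ?_⟩
  -- This choice gives `R ≤ 2 ^ k ≤ 2 * R`, the origin of the base `2 * R` in the bound.
  set k := (Nat.log 2 R).succ
  have hk1 : (R : ℝ) ≤ 2 ^ k := by exact_mod_cast (Nat.lt_pow_succ_log_self one_lt_two R).le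
  have hk2 : (2 : ℝ) ^ k ≤ 2 * R := by
    have := Nat.pow_log_le_self 2 hR
    rw [pow_succ, mul_comm]
    exact_mod_cast Nat.mul_le_mul_left 2 this
  have hR0 : (0 : ℝ) < R := by exact_mod_cast Nat.pos_of_ne_zero hR
  refine (hanti (div_le_div_of_nonneg_left (hx₁0.trans_le hx).le hR0 hk1)).trans ?_
  refine (key k x hx).trans ?_
  have : ((2 : ℝ) ^ m) ^ k ≤ (2 * R) ^ m := by
    rw [← pow_mul, mul_comm, pow_mul]
    gcongr
  have := tail_nonneg G x
  gcongr

/-- A Bonferroni inequality, by induction on inclusion–exclusion for two sets. -/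
theorem sum_measureReal_le_biUnion_add {Ω : Type*} [MeasurableSpace Ω] (P : Measure Ω)
    [IsFiniteMeasure P] {E : ℕ → Set Ω} (hE : ∀ i, MeasurableSet (E i)) (n : ℕ) :
    ∑ i ∈ Finset.range n, P.real (E i) ≤ P.real (⋃ i ∈ Finset.range n, E i) +
      ∑ i ∈ Finset.range n, ∑ j ∈ Finset.range i, P.real (E i ∩ E j) := by
  induction n with
  | zero => simp
  | succ n ih =>
    rw [Finset.sum_range_succ, Finset.sum_range_succ, Finset.range_add_one,
      Finset.set_biUnion_insert]
    have h1 := measureReal_union_add_inter (μ := P) (s := E n) (t := ⋃ i ∈ Finset.range n, E i)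
      (Finset.measurableSet_biUnion _ fun i _ => hE i) (measure_ne_top _ _) (measure_ne_top _ _)
    have h2 : P.real (E n ∩ ⋃ i ∈ Finset.range n, E i) ≤
        ∑ j ∈ Finset.range n, P.real (E n ∩ E j) := by
      rw [inter_iUnion₂]
      exact measureReal_biUnion_finset_le _ _
    linarith

/-- If at most one term exceeded the threshold, it would contribute at most `r * x` and the others
together at most `(1 - r) * x`. The denominator `n + 1` keeps the threshold positive also for `n =
0`. -/
theorem exists_pair_of_lt_sum {n : ℕ} {a : ℕ → ℝ} {r x : ℝ} (hr : r < 1) (hx : 0 < x)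
    (hmax : ∀ i < n, a i ≤ r * x) (hr0 : 0 < r) (hsum : x < ∑ i ∈ Finset.range n, a i) :
    ∃ i < n, ∃ j < i, (1 - r) / (n + 1) * x < a i ∧ (1 - r) / (n + 1) * x < a j := by
  by_contra! hno
  set s := (1 - r) / (n + 1) with hs
  have hs0 : 0 < s := div_pos (by linarith) (by positivity)
  have hns : n * (s * x) ≤ (1 - r) * x := by
    rw [← mul_assoc]
    gcongr
    rw [hs, mul_div_assoc', div_le_iff₀ (by positivity)]
    nlinarith
  have hothers : ∀ t : Finset ℕ, t ⊆ Finset.range n → (∀ j ∈ t, a j ≤ s * x) →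
      ∑ j ∈ t, a j ≤ (1 - r) * x := by
    intro t ht hle
    refine (Finset.sum_le_card_nsmul _ _ _ hle).trans (le_trans ?_ hns)
    rw [nsmul_eq_mul]
    have : (t.card : ℝ) ≤ n := by
      exact_mod_cast (Finset.card_le_card ht).trans_eq (Finset.card_range n)
    gcongr
  by_cases hbig : ∃ i < n, s * x < a i
  · obtain ⟨i, hi, hai⟩ := hbig
    rw [← Finset.add_sum_erase _ _ (Finset.mem_range.2 hi)] at hsum
    have := hothers ((Finset.range n).erase i) (Finset.erase_subset _ _) fun j hj => by
      obtain ⟨hji, hjn⟩ := Finset.mem_erase.1 hj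
      have hjn := Finset.mem_range.1 hjn
      rcases lt_or_gt_of_ne hji with h | h
      · exact hno i hi j h hai
      · by_contra! hj'
        exact absurd (hno j hjn i h hj') hai.not_ge
    have := hmax i hi
    linarith
  · push Not at hbig
    have := hothers _ subset_rfl fun j hj => hbig j (Finset.mem_range.1 hj)
    nlinarith

section Weighted

variable {Ω : Type*} [MeasurableSpace Ω] {P : Measure Ω}
  {G : Measure ℝ} {α c : ℝ} {h : ℝ → ℝ} {Y : ℕ → Ω → ℝ}

theorem RegularlyVarying.tendsto_scaled (hG : RegularlyVarying G α)
    (hlim : Tendsto (fun x => h x / tail G x) atTop (𝓝 c)) {k : ℝ} (hk : 0 < k) :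
    Tendsto (fun x => h (k * x) / tail G x) atTop (𝓝 (c * k ^ (-α))) := by
  have hx : Tendsto (fun x : ℝ => k * x) atTop atTop := tendsto_id.const_mul_atTop hk
  refine ((hlim.comp hx).mul (hG.limit k hk)).congr fun x => ?_
  simp only [Function.comp_apply]
  rw [div_mul_div_cancel₀ (hG.tail_pos _).ne']

theorem RegularlyVarying.tendsto_weighted (hG : RegularlyVarying G α)
    (hlim : Tendsto (fun x => h x / tail G x) atTop (𝓝 c))
    {Z : Ω → ℝ} (hZ : ∀ x, P.real {ω | x < Z ω} = h x) {w : ℝ} (hw : 0 ≤ w) {k : ℝ} (hk : 0 < k) :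
    Tendsto (fun x => P.real {ω | k * x < w * Z ω} / tail G x) atTop
      (𝓝 (c * (w ^ α * k ^ (-α)))) := by
  -- Zero weights matter because claims arriving after `T` receive discount factor `0`.
  rcases hw.eq_or_lt with rfl | hw
  · rw [Real.zero_rpow hG.index_pos.ne', zero_mul, mul_zero]
    refine tendsto_const_nhds.congr' ?_
    filter_upwards [eventually_gt_atTop 0] with x hx
    have : ¬ k * x < 0 := not_lt.2 (by positivity)
    simp [this]
  · have := hG.tendsto_scaled hlim (k := k / w) (by positivity)
    rw [Real.div_rpow hk.le hw.le, Real.rpow_neg hw.le, div_inv_eq_mul, mul_comm (k ^ _)] at this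
    refine this.congr fun x => ?_
    rw [← hZ]
    simp_rw [div_mul_eq_mul_div, div_lt_iff₀' hw]

theorem RegularlyVarying.tendsto_pair [IsFiniteMeasure P] (hG : RegularlyVarying G α)
    (hlim : Tendsto (fun x => h x / tail G x) atTop (𝓝 c)) (hY0 : ∀ i ω, 0 ≤ Y i ω)
    (hY : ∀ i x, P.real {ω | x < Y i ω} = h x) (hQ : QAI Y P) (w : ℕ → ℝ)
    {i j : ℕ} (hij : i ≠ j) {k : ℝ} (hk : 0 < k) :
    Tendsto (fun x => P.real {ω | k * x < w i * Y i ω ∧ k * x < w j * Y j ω} / tail G x) atTop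
      (𝓝 0) := by
  -- Both weights are replaced by one common positive bound, so that both variables face the same
  -- level, as in `QAI`.
  set M := max (max (w i) (w j)) 1
  have hM : 0 < M := lt_max_of_lt_right one_pos
  have hkM : 0 < k / M := by positivity
  have hx : Tendsto (fun x : ℝ => k / M * x) atTop atTop := tendsto_id.const_mul_atTop hkM
  have hprod := (((hQ i j hij).comp hx).mul ((hG.tendsto_scaled hlim hkM).const_mul 2))
  rw [zero_mul] at hprod
  refine squeeze_zero (fun x => div_nonneg measureReal_nonneg (tail_nonneg _ _)) (fun x => ?_) hprod
  simp only [Function.comp_apply, hY]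
  set p := P.real {ω | k / M * x < Y i ω ∧ k / M * x < Y j ω}
  have hle : p ≤ h (k / M * x) := by
    rw [← hY i]; exact measureReal_mono fun ω hω => hω.1
  have hp : p / (h (k / M * x) + h (k / M * x)) * (2 * (h (k / M * x) / tail G x)) =
      p / tail G x := by
    rcases eq_or_ne (h (k / M * x)) 0 with h0 | h0
    -- If the marginal tail vanishes, so does the joint one, and division by zero is harmless.
    · have : p = 0 := le_antisymm (hle.trans_eq h0) measureReal_nonneg
      simp [this]
    · generalize h (k / M * x) = b at h0
      rw [← two_mul]; field_simp
  rw [hp]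
  refine div_le_div_of_nonneg_right (measureReal_mono fun ω hω => ?_) (tail_nonneg _ _)
  have aux : ∀ l, w l ≤ M → k * x < w l * Y l ω → k / M * x < Y l ω := fun l hl hlt => by
    rw [div_mul_eq_mul_div, div_lt_iff₀' hM]
    exact hlt.trans_le (mul_le_mul_of_nonneg_right hl (hY0 l ω))
  exact ⟨aux i ((le_max_left _ _).trans (le_max_left _ _)) hω.1,
    aux j ((le_max_right _ _).trans (le_max_left _ _)) hω.2⟩

/-- The single big jump. Below, Bonferroni leaves only negligible pair terms. Above, a sum larger
than `x` needs either one term above `r * x` or two terms above a fixed multiple of `x`; then `r` is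
close to `1`. Keeping `E` abstract lets the vector event be squeezed directly. -/
theorem RegularlyVarying.tendsto_weightedSum [IsFiniteMeasure P] (hG : RegularlyVarying G α)
    (hlim : Tendsto (fun x => h x / tail G x) atTop (𝓝 c)) (hYm : ∀ i, Measurable (Y i))
    (hY0 : ∀ i ω, 0 ≤ Y i ω)
    (hY : ∀ i x, P.real {ω | x < Y i ω} = h x) (hQ : QAI Y P) {w : ℕ → ℝ} (hw : ∀ i, 0 ≤ w i)
    (n : ℕ) {E : ℝ → Set Ω}
    (hlow : ∀ x, 0 < x → P.real {ω | ∃ i < n, x < w i * Y i ω} ≤ P.real (E x))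
    (hupp : ∀ x, 0 < x → P.real (E x) ≤ P.real {ω | x < ∑ i ∈ Finset.range n, w i * Y i ω}) :
    Tendsto (fun x => P.real (E x) / tail G x) atTop
      (𝓝 (c * ∑ i ∈ Finset.range n, w i ^ α)) := by
  have hsingle := fun i {k : ℝ} (hk : 0 < k) => hG.tendsto_weighted hlim (hY i) (hw i) hk
  have hpair := fun {k : ℝ} (hk : 0 < k) => tendsto_finsetSum (Finset.range n) fun i _ =>
    tendsto_finsetSum (Finset.range i) fun j hj =>
      hG.tendsto_pair hlim hY0 hY hQ w (Finset.mem_range.1 hj).ne' hk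
  simp only [Finset.sum_const_zero] at hpair
  refine tendsto_order.2 ⟨fun a ha => ?_, fun b hb => ?_⟩
  · have hl := (tendsto_finsetSum (Finset.range n) fun i _ => hsingle i one_pos).sub
      (hpair one_pos)
    simp only [Real.one_rpow, mul_one, sub_zero, one_mul, ← Finset.mul_sum] at hl
    filter_upwards [hl.eventually (lt_mem_nhds ha), eventually_gt_atTop 0] with x hx hx0
    refine hx.trans_le ?_
    simp_rw [← Finset.sum_div]
    rw [← sub_div]
    refine div_le_div_of_nonneg_right ?_ (tail_nonneg _ _)
    refine le_trans ?_ (hlow x hx0)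
    have := sum_measureReal_le_biUnion_add P (E := fun i => {ω | x < w i * Y i ω})
      (fun i => measurableSet_lt measurable_const ((hYm i).const_mul _)) n
    have hset : (⋃ i ∈ Finset.range n, {ω | x < w i * Y i ω}) =
        {ω | ∃ i < n, x < w i * Y i ω} := by ext ω; simp
    rw [hset] at this
    exact sub_le_iff_le_add.2 this
  · obtain ⟨r, hrb, hr0, hr1⟩ : ∃ r : ℝ, c * (∑ i ∈ Finset.range n, w i ^ α) * r ^ (-α) < b ∧
        0 < r ∧ r < 1 := by
      have hc : Tendsto (fun r : ℝ => c * (∑ i ∈ Finset.range n, w i ^ α) * r ^ (-α)) (𝓝[<] 1)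
          (𝓝 (c * (∑ i ∈ Finset.range n, w i ^ α) * 1 ^ (-α))) :=
        ((Real.continuousAt_rpow_const 1 (-α) (Or.inl one_ne_zero)).tendsto.mono_left
          nhdsWithin_le_nhds).const_mul _
      rw [Real.one_rpow, mul_one] at hc
      have h0 : ∀ᶠ r : ℝ in 𝓝[<] 1, 0 < r :=
        (lt_mem_nhds one_pos).filter_mono nhdsWithin_le_nhds
      obtain ⟨r, h1, h2, h3⟩ :=
        ((hc.eventually (gt_mem_nhds hb)).and (h0.and self_mem_nhdsWithin)).exists
      exact ⟨r, h1, h2, h3⟩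
    have hs : 0 < (1 - r) / (n + 1) := div_pos (by linarith) (by positivity)
    have hu := (tendsto_finsetSum (Finset.range n) fun i _ => hsingle i hr0).add (hpair hs)
    simp only [add_zero, ← mul_assoc, ← Finset.mul_sum, ← Finset.sum_mul] at hu
    filter_upwards [hu.eventually (gt_mem_nhds hrb), eventually_gt_atTop 0] with x hx hx0
    refine lt_of_le_of_lt ?_ hx
    simp_rw [← Finset.sum_div]
    rw [← add_div]
    refine div_le_div_of_nonneg_right ((hupp x hx0).trans ?_) (tail_nonneg _ _)
    have hsub : {ω | x < ∑ i ∈ Finset.range n, w i * Y i ω} ⊆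
        (⋃ i ∈ Finset.range n, {ω | r * x < w i * Y i ω}) ∪
        ⋃ i ∈ Finset.range n, ⋃ j ∈ Finset.range i,
          {ω | (1 - r) / (n + 1) * x < w i * Y i ω ∧ (1 - r) / (n + 1) * x < w j * Y j ω} := by
      intro ω hω
      by_cases hmax : ∀ i < n, w i * Y i ω ≤ r * x
      · obtain ⟨i, hi, j, hj, hij⟩ := exists_pair_of_lt_sum hr1 hx0 hmax hr0 hω
        exact Or.inr (mem_iUnion₂.2 ⟨i, Finset.mem_range.2 hi,
          mem_iUnion₂.2 ⟨j, Finset.mem_range.2 hj, hij⟩⟩)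
      · push Not at hmax
        obtain ⟨i, hi, h⟩ := hmax
        exact Or.inl (mem_iUnion₂.2 ⟨i, Finset.mem_range.2 hi, h⟩)
    refine (measureReal_mono hsub).trans ((measureReal_union_le _ _).trans ?_)
    refine add_le_add (measureReal_biUnion_finset_le _ _)
      ((measureReal_biUnion_finset_le _ _).trans ?_)
    exact Finset.sum_le_sum fun i _ => measureReal_biUnion_finset_le _ _

/-- By pigeonhole some term exceeds `x / n`. The product `n * M` is a natural number so that
`RegularlyVarying.exists_dominated` applies to it. -/
theorem measureReal_lt_weightedSum_le [IsFiniteMeasure P] {h : ℝ → ℝ} (hY0 : ∀ i ω, 0 ≤ Y i ω)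
    (hY : ∀ i x, P.real {ω | x < Y i ω} = h x) {w : ℕ → ℝ} {n M : ℕ} (hM : M ≠ 0)
    (hwM : ∀ i, w i ≤ M) {x : ℝ} (hx : 0 < x) :
    P.real {ω | x < ∑ i ∈ Finset.range n, w i * Y i ω} ≤ n * h (x / (n * M : ℕ)) := by
  have hsub : {ω | x < ∑ i ∈ Finset.range n, w i * Y i ω} ⊆
      ⋃ i ∈ Finset.range n, {ω | x / (n * M : ℕ) < Y i ω} := by
    intro ω hω
    by_contra hno
    simp only [Finset.mem_range, mem_iUnion, exists_prop, not_exists, not_and] at hno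
    have hle : ∀ i ∈ Finset.range n, w i * Y i ω ≤ x / n := fun i hi => by
      have hi' := Finset.mem_range.1 hi
      have hn : (0 : ℝ) < n := by exact_mod_cast (Nat.zero_le i).trans_lt hi'
      have hM' : (0 : ℝ) < M := by exact_mod_cast Nat.pos_of_ne_zero hM
      have h1 : Y i ω ≤ x / (n * M : ℕ) := not_lt.1 (hno i hi')
      calc w i * Y i ω ≤ M * (x / (n * M : ℕ)) :=
            mul_le_mul (hwM i) h1 (hY0 i ω) hM'.le
        _ = x / n := by push_cast; field_simp
    have := Finset.sum_le_card_nsmul _ _ _ hle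
    rw [Finset.card_range, nsmul_eq_mul] at this
    have hlt : x < ∑ i ∈ Finset.range n, w i * Y i ω := hω
    rcases Nat.eq_zero_or_pos n with rfl | hn
    · simp at hlt; linarith
    · have hn' : (n : ℝ) ≠ 0 := by exact_mod_cast hn.ne'
      rw [mul_div_cancel₀ _ hn'] at this
      linarith
  refine (measureReal_mono hsub (measure_ne_top _ _)).trans
    ((measureReal_biUnion_finset_le _ _).trans_eq ?_)
  simp [hY]

end Weighted

/-! ### The counting process -/

section Renewal

variable {Ω : Type*} {θ : ℕ → Ω → ℝ≥0}

theorem arrivalTime_mono (θ : ℕ → Ω → ℝ≥0) (ω : Ω) : Monotone fun i => arrivalTime θ i ω :=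
  fun _ _ hij => Finset.sum_le_sum_of_subset (Finset.range_mono (by omega))

/-- Index `i` denotes claim number `i + 1`, hence the strict inequality on the left. -/
theorem natCast_lt_claimCount_iff {t : ℝ≥0} {i : ℕ} {ω : Ω} :
    (i : ℕ∞) < claimCount θ t ω ↔ arrivalTime θ i ω ≤ t := by
  simp only [claimCount, lt_iSup_iff, exists_prop]
  constructor
  · rintro ⟨j, hj, hij⟩
    have : i < j + 1 := by exact_mod_cast hij
    exact (arrivalTime_mono θ ω (Nat.lt_succ_iff.1 this)).trans hj
  · exact fun h => ⟨i, h, by exact_mod_cast Nat.lt_succ_self i⟩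

theorem arrivalTime_le_of_lt_toNat {t : ℝ≥0} {i : ℕ} {ω : Ω}
    (h : i < (claimCount θ t ω).toNat) : arrivalTime θ i ω ≤ t := by
  refine natCast_lt_claimCount_iff.1 ?_
  by_contra! hle
  exact absurd (ENat.toNat_le_toNat hle (ENat.natCast_ne_top i)) (by simpa using h)

theorem measurable_arrivalTime [MeasurableSpace Ω] (hθ : ∀ i, Measurable (θ i)) (i : ℕ) :
    Measurable (arrivalTime θ i) :=
  Finset.measurable_sum _ fun k _ => hθ k

theorem measurable_claimCount [MeasurableSpace Ω] (hθ : ∀ i, Measurable (θ i)) (t : ℝ≥0) :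
    Measurable (claimCount θ t) := by
  have hset : ∀ n : ℕ, MeasurableSet {ω | (n : ℕ∞) < claimCount θ t ω} := fun n => by
    simp_rw [natCast_lt_claimCount_iff]
    exact measurable_arrivalTime hθ n measurableSet_Iic
  refine ENat.measurable_iff.2 fun n => ?_
  have : claimCount θ t ⁻¹' {(n : ℕ∞)} =
      (⋂ i ∈ Finset.range n, {ω | (i : ℕ∞) < claimCount θ t ω}) \
        {ω | (n : ℕ∞) < claimCount θ t ω} := by
    ext ω
    simp only [mem_preimage, mem_singleton_iff, Set.mem_sdiff, mem_iInter, Finset.mem_range,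
      mem_ofPred_eq, not_lt]
    constructor
    · intro h
      rw [h]
      exact ⟨fun i hi => by exact_mod_cast hi, le_rfl⟩
    · rintro ⟨h1, h2⟩
      refine le_antisymm h2 ?_
      cases n with
      | zero => simp
      | succ n =>
        push_cast
        exact Order.add_one_le_of_lt (h1 n n.lt_succ_self)
  rw [this]
  exact (Finset.measurableSet_biInter _ fun i _ => hset i).diff (hset n)

/-- The arrival times are functions of the counting process. -/
theorem measurable_arrivalTime_iSup (i : ℕ) :
    Measurable[⨆ t, MeasurableSpace.comap (claimCount θ t) inferInstance] (arrivalTime θ i) := by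
  refine measurable_of_Iic (mδ := ⨆ t, MeasurableSpace.comap (claimCount θ t) inferInstance)
    fun t => ?_
  have : arrivalTime θ i ⁻¹' Iic t = claimCount θ t ⁻¹' Ioi (i : ℕ∞) := by
    ext ω; exact natCast_lt_claimCount_iff.symm
  rw [this]
  exact (le_iSup (fun t => MeasurableSpace.comap (claimCount θ t) inferInstance) t) _
    ⟨_, MeasurableSet.of_discrete, rfl⟩

variable [mΩ : MeasurableSpace Ω] {P : Measure Ω}

theorem IsRenewal.ae_claimCount_ne_top (hθ : IsRenewal θ P) (t : ℝ≥0) :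
    ∀ᵐ ω ∂P, claimCount θ t ω ≠ ⊤ := by
  have hm : Measurable fun ω => (claimCount θ t ω : ℝ≥0∞) :=
    (Measurable.of_discrete (f := ((↑) : ℕ∞ → ℝ≥0∞))).comp (measurable_claimCount hθ.measurable t)
  filter_upwards [ae_lt_top hm (hθ.finite t).ne] with ω hω h
  simp [h] at hω

variable [IsProbabilityMeasure P]

/-- Equality with `1` would force every inter-arrival time to vanish almost surely, giving
infinitely many arrivals at time `0` and contradicting finiteness of the renewal function. -/
theorem IsRenewal.mgf_neg_one_lt_one (hθ : IsRenewal θ P) :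
    mgf (fun ω => (θ 0 ω : ℝ)) P (-1) < 1 := by
  have hle : ∀ ω, Real.exp (-1 * (θ 0 ω : ℝ)) ≤ 1 := fun ω =>
    Real.exp_le_one_iff.2 (by have := (θ 0 ω).2; simp)
  have hmeas : Measurable fun ω => Real.exp (-1 * (θ 0 ω : ℝ)) :=
    ((hθ.measurable 0).coe_nnreal_real.const_mul _).exp
  have hint : Integrable (fun ω => Real.exp (-1 * (θ 0 ω : ℝ))) P :=
    Integrable.of_bound hmeas.aestronglyMeasurable 1 (Eventually.of_forall fun ω => by
      rw [Real.norm_of_nonneg (Real.exp_pos _).le]; exact hle ω)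
  have hle1 : mgf (fun ω => (θ 0 ω : ℝ)) P (-1) ≤ 1 := by
    refine (integral_mono hint (integrable_const 1) hle).trans_eq (by simp)
  refine lt_of_le_of_ne hle1 fun heq => ?_
  have hzero : ∫ ω, (1 - Real.exp (-1 * (θ 0 ω : ℝ))) ∂P = 0 := by
    rw [integral_sub (integrable_const 1) hint]
    simpa [mgf, sub_eq_zero] using heq.symm
  rw [integral_eq_zero_iff_of_nonneg (fun ω => sub_nonneg.2 (hle ω))
    ((integrable_const 1).sub hint)] at hzero
  have h0 : ∀ᵐ ω ∂P, θ 0 ω ∈ ({0} : Set ℝ≥0) := by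
    filter_upwards [hzero] with ω hω
    have : Real.exp (-1 * (θ 0 ω : ℝ)) = 1 := (sub_eq_zero.1 hω).symm
    rw [Real.exp_eq_one_iff] at this
    simpa using this
  have hall : ∀ᵐ ω ∂P, ∀ i, θ i ω = 0 := ae_all_iff.2 fun i =>
    (hθ.identDistrib i).symm.ae_mem_snd (measurableSet_singleton 0) h0
  have hfalse : ∀ᵐ _ω ∂P, False := by
    filter_upwards [hall, hθ.ae_claimCount_ne_top 0] with ω hω hne
    refine hne (ENat.eq_top_iff_forall_gt.2 fun n => natCast_lt_claimCount_iff.2 ?_)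
    simp [arrivalTime, hω]
  simpa using hfalse.exists

/-- Chernoff's bound with parameter `-1`; independence turns the transform of the sum into a power.
-/
theorem IsRenewal.measureReal_arrivalTime_le (hθ : IsRenewal θ P) (t : ℝ≥0) (i : ℕ) :
    P.real {ω | arrivalTime θ i ω ≤ t} ≤
      Real.exp t * mgf (fun ω => (θ 0 ω : ℝ)) P (-1) ^ (i + 1) := by
  have hmeas : ∀ k, Measurable fun ω => (θ k ω : ℝ) := fun k =>
    (hθ.measurable k).coe_nnreal_real
  have hind : iIndepFun (fun k ω => (θ k ω : ℝ)) P :=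
    hθ.indep.comp (fun _ x => (x : ℝ)) fun _ => measurable_coe_nnreal_real
  have hmgf := hind.mgf_sum (t := -1) hmeas (Finset.range (i + 1))
  have hid : ∀ k, mgf (fun ω => (θ k ω : ℝ)) P (-1) = mgf (fun ω => (θ 0 ω : ℝ)) P (-1) :=
    fun k => ((hθ.identDistrib k).comp
      ((measurable_coe_nnreal_real.const_mul (-1)).exp)).integral_eq
  simp only [hid, Finset.prod_const, Finset.card_range] at hmgf
  set S := ∑ k ∈ Finset.range (i + 1), fun ω => (θ k ω : ℝ) with hS
  have hSapp : ∀ ω, S ω = arrivalTime θ i ω := fun ω => by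
    simp [hS, arrivalTime, Finset.sum_apply]
  have hSm : Measurable S := by
    simp_rw [funext hSapp]
    exact (measurable_arrivalTime hθ.measurable i).coe_nnreal_real
  have hint : Integrable (fun ω => Real.exp (-1 * S ω)) P :=
    Integrable.of_bound (hSm.const_mul _).exp.aestronglyMeasurable 1
      (Eventually.of_forall fun ω => by
        rw [Real.norm_of_nonneg (Real.exp_pos _).le, Real.exp_le_one_iff, hSapp]
        simp)
  have := measure_le_le_exp_mul_mgf (μ := P) (X := S) (t := -1) (t : ℝ) (by norm_num) hint
  rw [hmgf] at this
  simpa [hSapp] using this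

/-- The law of `N(t)` has a geometric bound, so all its moments are finite. -/
theorem IsRenewal.integrable_claimCount_pow (hθ : IsRenewal θ P) (t : ℝ≥0) (m : ℕ) :
    Integrable (fun ω => ((claimCount θ t ω).toNat : ℝ) ^ m) P := by
  set r := mgf (fun ω => (θ 0 ω : ℝ)) P (-1)
  have hr0 : 0 ≤ r := mgf_nonneg
  have hr1 : r < 1 := hθ.mgf_neg_one_lt_one
  have hN : Measurable fun ω => (claimCount θ t ω).toNat :=
    (Measurable.of_discrete (f := ENat.toNat)).comp (measurable_claimCount hθ.measurable t)
  have hpow : Measurable fun n : ℕ => (n : ℝ) ^ m := Measurable.of_discrete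
  refine ⟨(hpow.comp hN).aestronglyMeasurable, ?_⟩
  rw [hasFiniteIntegral_iff_ofReal (Eventually.of_forall fun ω => by positivity)]
  have h1 := lintegral_map (μ := P) hpow.ennreal_ofReal hN
  rw [← h1, lintegral_countable']
  have hprob : ∀ n : ℕ, P.real ((fun ω => (claimCount θ t ω).toNat) ⁻¹' {n}) ≤
      Real.exp t * r ^ n := by
    rintro (_ | i)
    · exact measureReal_le_one.trans (by simp)
    · refine (measureReal_mono fun ω hω => ?_).trans (hθ.measureReal_arrivalTime_le t i)
      have : (claimCount θ t ω).toNat = i + 1 := hω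
      exact arrivalTime_le_of_lt_toNat (by omega)
  have hsum : Summable fun n : ℕ => (n : ℝ) ^ m * (Real.exp t * r ^ n) := by
    have := (summable_pow_mul_geometric_of_norm_lt_one m
      (by rwa [Real.norm_of_nonneg hr0] : ‖r‖ < 1)).mul_left (Real.exp t)
    exact this.congr fun n => by ring
  refine lt_of_le_of_lt (ENNReal.tsum_le_tsum fun n => ?_) hsum.tsum_ofReal_lt_top
  rw [Measure.map_apply hN (measurableSet_singleton n), ← ofReal_measureReal,
    ← ENNReal.ofReal_mul (by positivity)]
  exact ENNReal.ofReal_le_ofReal (mul_le_mul_of_nonneg_left (hprob n) (by positivity))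

end Renewal

/-! ### Independence of the claims, the counting process and the investment process -/

theorem lintegral_indepFun {Ω β β' : Type*} [MeasurableSpace Ω] [MeasurableSpace β]
    [MeasurableSpace β'] {P : Measure Ω} [IsProbabilityMeasure P] {U : Ω → β} {V : Ω → β'}
    (hUV : IndepFun U V P) (hU : Measurable U) (hV : Measurable V) {f : β × β' → ℝ≥0∞}
    (hf : Measurable f) :
    ∫⁻ ω, f (U ω, V ω) ∂P = ∫⁻ u, ∫⁻ ω, f (u, V ω) ∂P ∂(P.map U) := by
  have hprod := (indepFun_iff_map_prod_eq_prod_map_map hU.aemeasurable hV.aemeasurable).1 hUV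
  rw [← lintegral_map hf (hU.prodMk hV), hprod, lintegral_prod _ hf.aemeasurable]
  refine lintegral_congr fun u => ?_
  exact lintegral_map (f := fun v => f (u, v)) (hf.comp measurable_prodMk_left) hV

/-- Conditioning in Fubini form: `U` is frozen and only `V` is integrated. It is applied with `U`
the claim count and discount factors, and `V` the claims. -/
theorem measureReal_indepFun {Ω β β' : Type*} [MeasurableSpace Ω] [MeasurableSpace β]
    [MeasurableSpace β'] {P : Measure Ω} [IsProbabilityMeasure P] {U : Ω → β} {V : Ω → β'}
    (hUV : IndepFun U V P) (hU : Measurable U) (hV : Measurable V) {S : Set (β × β')}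
    (hS : MeasurableSet S) :
    Measurable (fun ω => P.real {ω' | (U ω, V ω') ∈ S}) ∧
      P.real {ω | (U ω, V ω) ∈ S} = ∫ ω, P.real {ω' | (U ω, V ω') ∈ S} ∂P := by
  have hsec : ∀ u, P {ω' | (u, V ω') ∈ S} = P.map V (Prod.mk u ⁻¹' S) := fun u => by
    rw [Measure.map_apply hV (measurable_prodMk_left hS)]
    rfl
  have hm : Measurable fun u => P {ω' | (u, V ω') ∈ S} := by
    have := Measure.isProbabilityMeasure_map (μ := P) hV.aemeasurable
    simp_rw [hsec]
    exact measurable_measure_prodMk_left hS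
  refine ⟨(hm.comp hU).ennreal_toReal, ?_⟩
  have h1 := lintegral_indepFun hUV hU hV (f := S.indicator 1) (measurable_one.indicator hS)
  have h2 : ∀ u, ∫⁻ ω, S.indicator 1 (u, V ω) ∂P = P {ω | (u, V ω) ∈ S} := fun u =>
    lintegral_indicator_one (hV (measurable_prodMk_left hS))
  have h3 : ∫⁻ ω, S.indicator 1 (U ω, V ω) ∂P = P {ω | (U ω, V ω) ∈ S} :=
    lintegral_indicator_one ((hU.prodMk hV) hS)
  rw [h3] at h1
  simp_rw [h2] at h1
  rw [lintegral_map hm hU] at h1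
  simp only [measureReal_def]
  rw [h1]
  exact (integral_toReal (hm.comp hU).aemeasurable
    (Eventually.of_forall fun _ => measure_lt_top _ _)).symm

section Weights

variable {Ω : Type*} {d : ℕ} {θ : ℕ → Ω → ℝ≥0} {ξ : ℝ≥0 → Ω → ℝ} {T : ℝ≥0}

/-- The discount factor `e^{-ξ(τ_i)}` of the `i`-th claim, set to `0` if the claim arrives after
the time `T`. -/
noncomputable def discountFactor (θ : ℕ → Ω → ℝ≥0) (ξ : ℝ≥0 → Ω → ℝ) (T : ℝ≥0) (i : ℕ) (ω : Ω) :
    ℝ :=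
  if arrivalTime θ i ω ≤ T then Real.exp (-ξ (arrivalTime θ i ω) ω) else 0

theorem discountFactor_nonneg (i : ℕ) (ω : Ω) : 0 ≤ discountFactor θ ξ T i ω := by
  unfold discountFactor
  split_ifs
  exacts [(Real.exp_pos _).le, le_rfl]

theorem discountedClaims_eq_sum (X : ℕ → Ω → Fin d → ℝ) (ω : Ω) :
    discountedClaims X θ ξ T ω =
      ∑ i ∈ Finset.range (claimCount θ T ω).toNat, discountFactor θ ξ T i ω • X i ω := by
  refine Finset.sum_congr rfl fun i hi => ?_
  rw [discountFactor, if_pos (arrivalTime_le_of_lt_toNat (Finset.mem_range.1 hi))]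

theorem discountFactor_le {K : ℝ} {ω : Ω} (h : ∀ t : ℝ≥0, t ≤ T → -K ≤ ξ t ω) (i : ℕ) :
    discountFactor θ ξ T i ω ≤ Real.exp K := by
  unfold discountFactor
  split_ifs with hi
  · exact Real.exp_le_exp.2 (by linarith [h _ hi])
  · exact (Real.exp_pos _).le

theorem ofReal_discountFactor_rpow {α : ℝ} (hα : 0 < α) (i : ℕ) (ω : Ω) :
    ENNReal.ofReal (discountFactor θ ξ T i ω ^ α) =
      (Iic T).indicator (fun s => ENNReal.ofReal (Real.exp (-α * ξ s ω))) (arrivalTime θ i ω) := by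
  unfold discountFactor
  by_cases h : arrivalTime θ i ω ≤ T
  · rw [if_pos h, indicator_of_mem (mem_Iic.2 h), ← Real.exp_mul]
    congr 2; ring
  · rw [if_neg h, indicator_of_notMem (by simpa using h), Real.zero_rpow hα.ne',
      ENNReal.ofReal_zero]

/-- Discount factors beyond the count vanish. Finiteness of the count is needed because `ENat.toNat`
sends `⊤` to `0`. -/
theorem ofReal_sum_discountFactor_rpow {α : ℝ} (hα : 0 < α) {ω : Ω} (hω : claimCount θ T ω ≠ ⊤) :
    ENNReal.ofReal (∑ i ∈ Finset.range (claimCount θ T ω).toNat, discountFactor θ ξ T i ω ^ α) =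
      ∑' i, ENNReal.ofReal (discountFactor θ ξ T i ω ^ α) := by
  rw [ENNReal.ofReal_sum_of_nonneg fun i _ => Real.rpow_nonneg (discountFactor_nonneg i ω) α,
    tsum_eq_sum]
  intro i hi
  have : ¬ arrivalTime θ i ω ≤ T := by
    rw [← natCast_lt_claimCount_iff, ← ENat.natCast_toNat hω]
    simpa using hi
  rw [discountFactor, if_neg this, Real.zero_rpow hα.ne', ENNReal.ofReal_zero]

/-- Evaluating `ξ` at the random time requires its joint measurability. The target σ-algebra `m` is
left free, to serve both for the ambient one and for the join of the counting and investment
information. -/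
theorem measurable_discountFactor {𝓗 𝓖 m : MeasurableSpace Ω} (h1 : 𝓗 ≤ m) (h2 : 𝓖 ≤ m)
    (hτ : ∀ i, Measurable[𝓗] (arrivalTime θ i))
    (hξ : @Measurable (ℝ≥0 × Ω) ℝ (@Prod.instMeasurableSpace ℝ≥0 Ω _ 𝓖) _ (fun p => ξ p.1 p.2))
    (i : ℕ) : Measurable[m] (discountFactor θ ξ T i) := by
  have hτm : Measurable[m] (arrivalTime θ i) := (hτ i).mono h1 le_rfl
  have hpair : @Measurable Ω (ℝ≥0 × Ω) m (@Prod.instMeasurableSpace ℝ≥0 Ω _ 𝓖)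
      (fun ω => (arrivalTime θ i ω, ω)) :=
    @Measurable.prodMk Ω m ℝ≥0 Ω _ 𝓖 _ _ hτm (measurable_id.mono h2 le_rfl)
  have hcomp : Measurable[m] fun ω => ξ (arrivalTime θ i ω) ω := hξ.comp hpair
  exact Measurable.ite (hτm measurableSet_Iic) hcomp.neg.exp measurable_const

variable [mΩ : MeasurableSpace Ω] {P : Measure Ω} [IsProbabilityMeasure P]

/-- The information in the claims is independent of that in the counting process and the
investment process taken together. -/
theorem MutuallyIndependent.exists_indepFun {X : ℕ → Ω → Fin d → ℝ}
    (hX : ∀ i, Measurable (X i)) (hθ : ∀ i, Measurable (θ i))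
    (h : MutuallyIndependent X θ ξ P) (T : ℝ≥0) :
    Measurable (fun p : ℝ≥0 × Ω => ξ p.1 p.2) ∧
    (∀ i, Measurable (discountFactor θ ξ T i)) ∧
    IndepFun (fun ω => ((claimCount θ T ω).toNat, fun i => discountFactor θ ξ T i ω))
      (fun ω i => X i ω) P ∧
    ∀ (i : ℕ) (α : ℝ), ∫⁻ ω, (Iic T).indicator
        (fun s => ENNReal.ofReal (Real.exp (-α * ξ s ω))) (arrivalTime θ i ω) ∂P =
      ∫⁻ s in Iic T, ∫⁻ ω, ENNReal.ofReal (Real.exp (-α * ξ s ω)) ∂P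
        ∂(P.map (arrivalTime θ i)) := by
  have hτ' := measurable_arrivalTime hθ
  have hN := measurable_claimCount hθ
  obtain ⟨𝓖, h𝓖, hξ, hind⟩ := h
  set mX := ⨆ i, MeasurableSpace.comap (X i) inferInstance with hmX
  set mN := ⨆ t, MeasurableSpace.comap (claimCount θ t) inferInstance with hmN
  have hmX_le : mX ≤ mΩ := iSup_le fun i => measurable_iff_comap_le.1 (hX i)
  have hmN_le : mN ≤ mΩ := iSup_le fun t => measurable_iff_comap_le.1 (hN t)
  have hτ : ∀ i, Measurable[mN] (arrivalTime θ i) := measurable_arrivalTime_iSup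
  refine ⟨hξ.mono (sup_le_sup le_rfl (MeasurableSpace.comap_mono h𝓖)) le_rfl,
    measurable_discountFactor hmN_le h𝓖 hτ hξ, ?_, fun i α => ?_⟩
  · have hle : ∀ i, (![mX, mN, 𝓖] : Fin 3 → MeasurableSpace Ω) i ≤ mΩ := by
      intro i; fin_cases i <;> assumption
    have hdisj : Disjoint ({1, 2} : Set (Fin 3)) {0} := by simp
    have hsup := indep_iSup_of_disjoint hle hind hdisj
    simp only [iSup_insert, iSup_singleton] at hsup
    have hsup' : Indep (mN ⊔ 𝓖) mX P := hsup
    refine (IndepFun_iff_Indep _ _ _).2 (indep_of_indep_of_le_left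
      (indep_of_indep_of_le_right hsup' ?_) ?_)
    · refine (measurable_iff_comap_le (m₁ := mX)).1
        (@measurable_pi_lambda _ _ _ mX _ _ fun i => ?_)
      exact measurable_iff_comap_le.2 (le_iSup (fun i => MeasurableSpace.comap (X i) _) i)
    · refine (measurable_iff_comap_le (m₁ := mN ⊔ 𝓖)).1 (Measurable.prodMk ?_
        (@measurable_pi_lambda _ _ _ (mN ⊔ 𝓖) _ _
          (measurable_discountFactor le_sup_left le_sup_right hτ hξ)))
      refine (Measurable.of_discrete (f := ENat.toNat)).comp ?_
      exact measurable_iff_comap_le.2 ((le_iSup (fun t => MeasurableSpace.comap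
        (claimCount θ t) _) T).trans le_sup_left)
  · have hNG : Indep mN 𝓖 P := hind.indep (i := 1) (j := 2) (by decide)
    -- The identity into `Ω` equipped with `𝓖` carries the whole investment path, so Fubini applies
    -- to `(τ_i, ω)`.
    have hτG : @IndepFun Ω ℝ≥0 Ω mΩ _ 𝓖 (arrivalTime θ i) id P := by
      refine (@IndepFun_iff_Indep Ω ℝ≥0 Ω mΩ _ 𝓖 _ _ P).2 ?_
      rw [MeasurableSpace.comap_id]
      exact indep_of_indep_of_le_left hNG (measurable_iff_comap_le.1 (hτ i))
    have hf : @Measurable (ℝ≥0 × Ω) ℝ≥0∞ (@Prod.instMeasurableSpace ℝ≥0 Ω _ 𝓖) _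
        ((Prod.fst ⁻¹' Iic T).indicator fun p => ENNReal.ofReal (Real.exp (-α * ξ p.1 p.2))) :=
      Measurable.indicator (hξ.const_mul _).exp.ennreal_ofReal (measurable_fst measurableSet_Iic)
    have := @lintegral_indepFun Ω ℝ≥0 Ω mΩ _ 𝓖 P _ _ _ hτG (hτ' i) (measurable_id.mono h𝓖 le_rfl) _
      hf
    rw [← lintegral_indicator measurableSet_Iic]
    refine Eq.trans ?_ (this.trans (lintegral_congr fun s => ?_))
    · rfl
    · by_cases hs : s ∈ Iic T
      · rw [indicator_of_mem hs]
        exact lintegral_congr fun ω => indicator_of_mem (s := Prod.fst ⁻¹' Iic T) hs _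
      · rw [indicator_of_notMem hs]
        exact (lintegral_congr fun ω =>
          indicator_of_notMem (s := Prod.fst ⁻¹' Iic T) hs _).trans lintegral_zero

end Weights

theorem measurable_sum_range {Ω : Type*} [MeasurableSpace Ω] {N : Ω → ℕ} (hN : Measurable N)
    {f : ℕ → Ω → ℝ} (hf : ∀ i, Measurable (f i)) :
    Measurable fun ω => ∑ i ∈ Finset.range (N ω), f i ω := by
  have hpartial : ∀ n : ℕ, Measurable fun ω => ∑ i ∈ Finset.range n, f i ω := fun n =>
    Finset.measurable_fun_sum _ fun i _ => hf i
  exact (measurable_from_prod_countable_right (f := fun q : ℕ × Ω =>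
    ∑ i ∈ Finset.range q.1, f i q.2) hpartial).comp (hN.prodMk measurable_id)

section Claims

variable {Ω : Type*} [MeasurableSpace Ω] {P : Measure Ω} {d : ℕ} {X : ℕ → Ω → Fin d → ℝ}
  {F : Measure (Fin d → ℝ)} {A : Set (Fin d → ℝ)}

theorem IsClaimSequence.ae_nonneg (hX : IsClaimSequence X F P) : ∀ᵐ ω ∂P, ∀ i, 0 ≤ X i ω :=
  ae_all_iff.2 fun i => by
    refine ae_of_ae_map (p := fun z => 0 ≤ z) (hX.measurable i).aemeasurable ?_
    rw [hX.law i]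
    exact mem_ae_iff.2 hX.nonneg

theorem IsClaimSequence.measureReal_lt_scale (hX : IsClaimSequence X F P) (hA : IsRareSet A)
    (i : ℕ) (x : ℝ) : P.real {ω | x < scale A (X i ω)} = tail (lawOn F A) x := by
  rw [tail, lawOn, map_measureReal_apply (measurable_scale hA) measurableSet_Ioi, ← hX.law i,
    map_measureReal_apply (hX.measurable i) (measurable_scale hA measurableSet_Ioi)]
  rfl

variable [IsProbabilityMeasure P]

theorem IsClaimSequence.isProbabilityMeasure_lawOn (hX : IsClaimSequence X F P)
    (hA : IsRareSet A) : IsProbabilityMeasure (lawOn F A) := by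
  have : IsProbabilityMeasure F := by
    rw [← hX.law 0]
    exact Measure.isProbabilityMeasure_map (hX.measurable 0).aemeasurable
  exact Measure.isProbabilityMeasure_map (measurable_scale hA).aemeasurable

theorem IsClaimSequence.measureReal_exists_le (hX : IsClaimSequence X F P) (hA : IsRareSet A)
    {w : ℕ → ℝ} (hw : ∀ i, 0 ≤ w i) (n : ℕ) {x : ℝ} (hx : 0 < x) :
    P.real {ω | ∃ i < n, x < w i * scale A (X i ω)} ≤
      P.real {ω | ∑ i ∈ Finset.range n, w i • X i ω ∈ x • A} := by
  refine ENNReal.toReal_mono (measure_ne_top _ _) (measure_mono_ae ?_)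
  filter_upwards [hX.ae_nonneg] with ω hω
  rintro ⟨i, hi, hlt⟩
  rw [← hA.scale_smul (hw i), hA.lt_scale_iff hx] at hlt
  exact hA.mem_smul_of_le hx hlt (Finset.single_le_sum (f := fun i => w i • X i ω)
    (fun j _ => smul_nonneg (hw j) (hω j)) (Finset.mem_range.2 hi))

theorem IsRareSet.measureReal_le_weightedSum (hA : IsRareSet A) {w : ℕ → ℝ} (hw : ∀ i, 0 ≤ w i)
    (n : ℕ) {x : ℝ} (hx : 0 < x) :
    P.real {ω | ∑ i ∈ Finset.range n, w i • X i ω ∈ x • A} ≤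
      P.real {ω | x < ∑ i ∈ Finset.range n, w i * scale A (X i ω)} :=
  measureReal_mono fun ω hω => ((hA.lt_scale_iff hx).2 hω).trans_le
    (hA.scale_sum_le _ hw fun i => X i ω)

theorem MRV.tendsto_tail_lawOn {α : ℝ} {μ : Measure (Fin d → ℝ)} {G : Measure ℝ}
    (h : MRV F α μ G) (hF : F (Ici 0)ᶜ = 0) (hA : IsRareSet A) :
    Tendsto (fun x => tail (lawOn F A) x / tail G x) atTop (𝓝 (μ.real A)) := by
  refine (h.tendsto_measureReal_smul hF hA).congr' ?_
  filter_upwards [eventually_gt_atTop 0] with x hx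
  rw [tail_lawOn hA F hx]

end Claims

/-! ### The asymptotics of the discounted aggregate claims -/

section Main

variable {Ω : Type*} [MeasurableSpace Ω] {P : Measure Ω} [IsProbabilityMeasure P] {d : ℕ}
  {X : ℕ → Ω → Fin d → ℝ} {θ : ℕ → Ω → ℝ≥0} {ξ : ℝ≥0 → Ω → ℝ} {F : Measure (Fin d → ℝ)}
  {A : Set (Fin d → ℝ)} {α : ℝ} {μ : Measure (Fin d → ℝ)} {G : Measure ℝ} {T : ℝ≥0} {K : ℝ}

theorem exp_neg_mul_le (hα : 0 < α) {k y : ℝ} (h : -k ≤ y) :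
    Real.exp (-α * y) ≤ Real.exp (α * k) :=
  Real.exp_le_exp.2 (by nlinarith)

/-- The limit is taken pointwise with the count and weights of `ω` frozen and the claims drawn from
an independent `ω'`, then integrated over `ω`. -/
theorem tendsto_measureReal_discountedClaims [IsProbabilityMeasure G]
    (hX : IsClaimSequence X F P) (hθ : IsRenewal θ P) (hind : MutuallyIndependent X θ ξ P)
    (hA : IsRareSet A) (hQAI : QAIOn A X P) (hMRV : MRV F α μ G)
    (hK : ∀ᵐ ω ∂P, ∀ t : ℝ≥0, t ≤ T → -K ≤ ξ t ω) :
    Tendsto (fun x : ℝ => P.real {ω | discountedClaims X θ ξ T ω ∈ x • A} / tail G x) atTop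
      (𝓝 (∫ ω, μ.real A *
        ∑ i ∈ Finset.range (claimCount θ T ω).toNat, discountFactor θ ξ T i ω ^ α ∂P)) := by
  obtain ⟨-, hWm, hVX, -⟩ := hind.exists_indepFun hX.measurable hθ.measurable T
  have hG := hMRV.regularlyVarying
  have := hX.isProbabilityMeasure_lawOn hA
  have hlim := hMRV.tendsto_tail_lawOn hX.nonneg hA
  have hYm : ∀ i, Measurable fun ω => scale A (X i ω) := fun i =>
    (measurable_scale hA).comp (hX.measurable i)
  have hY := hX.measureReal_lt_scale hA
  have hY0 : ∀ i ω, 0 ≤ scale A (X i ω) := fun i ω => scale_nonneg A _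
  have hN : Measurable fun ω => (claimCount θ T ω).toNat :=
    (Measurable.of_discrete (f := ENat.toNat)).comp (measurable_claimCount hθ.measurable T)
  have hVm : Measurable fun ω => ((claimCount θ T ω).toNat, fun i => discountFactor θ ξ T i ω) :=
    hN.prodMk (measurable_pi_lambda _ hWm)
  have hXm : Measurable fun ω i => X i ω := measurable_pi_lambda _ hX.measurable
  have hsum : Measurable fun p : (ℕ × (ℕ → ℝ)) × (ℕ → Fin d → ℝ) =>
      ∑ i ∈ Finset.range p.1.1, p.1.2 i • p.2 i := by
    have : Measurable fun q : ℕ × ((ℕ → ℝ) × (ℕ → Fin d → ℝ)) =>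
        ∑ i ∈ Finset.range q.1, q.2.1 i • q.2.2 i :=
      measurable_from_prod_countable_right fun n => by
        have hterm : ∀ i ∈ Finset.range n,
            Measurable fun q : (ℕ → ℝ) × (ℕ → Fin d → ℝ) => q.1 i • q.2 i := fun i _ =>
          ((measurable_pi_apply i).comp measurable_fst).smul
            ((measurable_pi_apply i).comp measurable_snd)
        exact Finset.measurable_fun_sum _ hterm
    exact this.comp ((measurable_fst.comp measurable_fst).prodMk
      ((measurable_snd.comp measurable_fst).prodMk measurable_snd))
  have hcond := fun {x : ℝ} (hx : 0 < x) => measureReal_indepFun hVX hVm hXm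
    (hsum (hA.isOpen.smul₀ hx.ne').measurableSet)
  obtain ⟨C, x₀, m, hC, hx₀, hdom⟩ := hG.exists_dominated (tail_antitone (lawOn F A))
    (tail_le_one _) hlim
  obtain ⟨M, hM⟩ := exists_nat_gt (Real.exp K)
  have hM0 : M ≠ 0 := by
    rintro rfl
    exact absurd hM (not_lt.2 (by simpa using (Real.exp_pos K).le))
  have hDCT := tendsto_integral_filter_of_dominated_convergence (μ := P) (l := atTop)
    (F := fun (x : ℝ) ω => P.real {ω' | ∑ i ∈ Finset.range (claimCount θ T ω).toNat,
      discountFactor θ ξ T i ω • X i ω' ∈ x • A} / tail G x)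
    (f := fun ω => μ.real A *
        ∑ i ∈ Finset.range (claimCount θ T ω).toNat, discountFactor θ ξ T i ω ^ α)
    -- One factor `n` comes from the union bound and `n ^ m` from the Potter-type bound at ratio `n
    -- * M`, where `M` exceeds every discount factor almost surely.
    (bound := fun ω => C * (2 * M) ^ m * ((claimCount θ T ω).toNat : ℝ) ^ (m + 1))
    ?_ ?_ ((hθ.integrable_claimCount_pow T (m + 1)).const_mul _) ?_
  · refine hDCT.congr' ?_
    filter_upwards [eventually_gt_atTop 0] with x hx
    rw [integral_div]
    congr 1
    simp_rw [discountedClaims_eq_sum]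
    exact (hcond hx).2.symm
  · filter_upwards [eventually_gt_atTop 0] with x hx
    exact ((hcond hx).1.div_const _).aestronglyMeasurable
  · filter_upwards [eventually_ge_atTop x₀] with x hx
    filter_upwards [hK] with ω hω
    have hx0 : 0 < x := hx₀.trans_le hx
    rw [Real.norm_of_nonneg (div_nonneg measureReal_nonneg (tail_nonneg _ _)),
      div_le_iff₀ (hG.tail_pos x)]
    set n := (claimCount θ T ω).toNat
    have hw := fun i => discountFactor_nonneg (θ := θ) (ξ := ξ) (T := T) i ω
    refine (hA.measureReal_le_weightedSum hw n hx0).trans ?_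
    refine (measureReal_lt_weightedSum_le hY0 hY hM0
      (fun i => (discountFactor_le hω i).trans hM.le) hx0).trans ?_
    rcases Nat.eq_zero_or_pos n with hn | hn
    · rw [hn]; simp
    · calc (n : ℝ) * tail (lawOn F A) (x / (n * M : ℕ))
          ≤ n * (C * (2 * (n * M : ℕ)) ^ m * tail G x) := by
            gcongr
            exact hdom x hx _ (Nat.mul_ne_zero hn.ne' hM0)
        _ = C * (2 * M) ^ m * (n : ℝ) ^ (m + 1) * tail G x := by
            push_cast; ring
  · refine Eventually.of_forall fun ω => ?_
    have hw := fun i => discountFactor_nonneg (θ := θ) (ξ := ξ) (T := T) i ω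
    exact hG.tendsto_weightedSum hlim hYm hY0 hY hQAI hw _
      (fun x hx => hX.measureReal_exists_le hA hw _ hx)
      (fun x hx => hA.measureReal_le_weightedSum hw _ hx)

theorem integrable_exp_neg_mul (hα : 0 < α) (hξ : Measurable fun p : ℝ≥0 × Ω => ξ p.1 p.2)
    (hK : ∀ᵐ ω ∂P, ∀ t : ℝ≥0, t ≤ T → -K ≤ ξ t ω) {s : ℝ≥0} (hs : s ≤ T) :
    Integrable (fun ω => Real.exp (-α * ξ s ω)) P := by
  refine Integrable.of_bound
    ((hξ.comp measurable_prodMk_left).const_mul (-α)).exp.aestronglyMeasurable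
    (Real.exp (α * K)) ?_
  filter_upwards [hK] with ω hω
  rw [Real.norm_of_nonneg (Real.exp_pos _).le]
  exact exp_neg_mul_le hα (hω s hs)

theorem integrableOn_integral_exp_neg_mul (hθ : IsRenewal θ P) (hα : 0 < α)
    (hξ : Measurable fun p : ℝ≥0 × Ω => ξ p.1 p.2)
    (hK : ∀ᵐ ω ∂P, ∀ t : ℝ≥0, t ≤ T → -K ≤ ξ t ω) :
    IntegrableOn (fun s => ∫ ω, Real.exp (-α * ξ s ω) ∂P) (Iic T) (renewalMeasure θ P) := by
  have hfin : renewalMeasure θ P (Iic T) < ∞ := by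
    rw [renewalMeasure_Iic hθ.measurable]; exact hθ.finite T
  have hmeas : StronglyMeasurable fun s : ℝ≥0 => ∫ ω, Real.exp (-α * ξ s ω) ∂P :=
    (hξ.const_mul (-α)).exp.stronglyMeasurable.integral_prod_right
  refine Measure.integrableOn_of_bounded (M := Real.exp (α * K)) hfin.ne
    hmeas.aestronglyMeasurable ?_
  refine (ae_restrict_iff' measurableSet_Iic).2 (Eventually.of_forall fun s hs => ?_)
  have := norm_integral_le_of_norm_le_const (μ := P) (f := fun ω => Real.exp (-α * ξ s ω))
    (C := Real.exp (α * K)) (by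
      filter_upwards [hK] with ω hω
      rw [Real.norm_of_nonneg (Real.exp_pos _).le]
      exact exp_neg_mul_le hα (hω s hs))
  simpa using this

/-- The integrand is strictly positive on `[0, T]`, which has positive renewal measure `λ(T)`. -/
theorem integral_exp_neg_mul_pos (hθ : IsRenewal θ P) (hα : 0 < α)
    (hξ : Measurable fun p : ℝ≥0 × Ω => ξ p.1 p.2)
    (hK : ∀ᵐ ω ∂P, ∀ t : ℝ≥0, t ≤ T → -K ≤ ξ t ω) (hT : 0 < renewalFunction θ P T) :
    0 < ∫ s in Iic T, (∫ ω, Real.exp (-α * ξ s ω) ∂P) ∂(renewalMeasure θ P) := by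
  rw [setIntegral_pos_iff_support_of_nonneg_ae
    (Eventually.of_forall fun s => integral_nonneg fun ω => (Real.exp_pos _).le)
    (integrableOn_integral_exp_neg_mul hθ hα hξ hK)]
  have : Iic T ⊆ Function.support fun s => ∫ ω, Real.exp (-α * ξ s ω) ∂P := fun s hs =>
    (integral_exp_pos (integrable_exp_neg_mul hα hξ hK hs)).ne'
  rwa [inter_eq_right.2 this, renewalMeasure_Iic hθ.measurable]

/-- A Campbell-type formula: Tonelli exchanges sum and expectation, independence of `τ_i` and `ξ`
integrates `ξ` out at each fixed time, and the laws of the arrival times add up to the renewal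
measure. -/
theorem integral_sum_discountFactor_rpow (hX : ∀ i, Measurable (X i)) (hθ : IsRenewal θ P)
    (hind : MutuallyIndependent X θ ξ P) (hα : 0 < α)
    (hK : ∀ᵐ ω ∂P, ∀ t : ℝ≥0, t ≤ T → -K ≤ ξ t ω) :
    ∫ ω, ∑ i ∈ Finset.range (claimCount θ T ω).toNat, discountFactor θ ξ T i ω ^ α ∂P =
      ∫ s in Iic T, (∫ ω, Real.exp (-α * ξ s ω) ∂P) ∂(renewalMeasure θ P) := by
  obtain ⟨hξ, hWm, -, hlaw⟩ := hind.exists_indepFun hX hθ.measurable T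
  have hN : Measurable fun ω => (claimCount θ T ω).toNat :=
    (Measurable.of_discrete (f := ENat.toNat)).comp (measurable_claimCount hθ.measurable T)
  have hSm := measurable_sum_range hN fun i => (hWm i).pow_const α
  rw [integral_eq_lintegral_of_nonneg_ae (Eventually.of_forall fun ω => Finset.sum_nonneg
      fun i _ => Real.rpow_nonneg (discountFactor_nonneg i ω) α) hSm.aestronglyMeasurable,
    integral_eq_lintegral_of_nonneg_ae
      (Eventually.of_forall fun s => integral_nonneg fun ω => (Real.exp_pos _).le)
      (integrableOn_integral_exp_neg_mul hθ hα hξ hK).aestronglyMeasurable]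
  congr 1
  calc ∫⁻ ω, ENNReal.ofReal (∑ i ∈ Finset.range (claimCount θ T ω).toNat,
          discountFactor θ ξ T i ω ^ α) ∂P
      = ∫⁻ ω, ∑' i, ENNReal.ofReal (discountFactor θ ξ T i ω ^ α) ∂P := by
        refine lintegral_congr_ae ?_
        filter_upwards [hθ.ae_claimCount_ne_top T] with ω hω
        exact ofReal_sum_discountFactor_rpow hα hω
    _ = ∑' i, ∫⁻ s in Iic T, ∫⁻ ω, ENNReal.ofReal (Real.exp (-α * ξ s ω)) ∂P
          ∂(P.map (arrivalTime θ i)) := by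
        rw [lintegral_tsum fun i => ((hWm i).pow_const α).ennreal_ofReal.aemeasurable]
        refine tsum_congr fun i => ?_
        simp_rw [ofReal_discountFactor_rpow hα]
        exact hlaw i α
    _ = ∫⁻ s in Iic T, ∫⁻ ω, ENNReal.ofReal (Real.exp (-α * ξ s ω)) ∂P
          ∂(renewalMeasure θ P) := by
        rw [renewalMeasure, Measure.restrict_sum _ measurableSet_Iic, lintegral_sum_measure]
    _ = ∫⁻ s in Iic T, ENNReal.ofReal (∫ ω, Real.exp (-α * ξ s ω) ∂P) ∂(renewalMeasure θ P) := by
        refine setLIntegral_congr_fun measurableSet_Iic fun s hs => ?_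
        exact (ofReal_integral_eq_lintegral_ofReal (integrable_exp_neg_mul hα hξ hK hs)
          (Eventually.of_forall fun ω => (Real.exp_pos _).le)).symm

end Main

end RenewalRisk

theorem corollary3p1 {Ω : Type*} [MeasurableSpace Ω] (P : Measure Ω) [IsProbabilityMeasure P]
    (d : ℕ) (X : ℕ → Ω → Fin d → ℝ) (θ : ℕ → Ω → ℝ≥0) (ξ : ℝ≥0 → Ω → ℝ)
    (F : Measure (Fin d → ℝ)) (A : Set (Fin d → ℝ))
    (α : ℝ) (μ : Measure (Fin d → ℝ)) (G : Measure ℝ) [IsProbabilityMeasure G]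
    (hX : RenewalRisk.IsClaimSequence X F P)
    (hθ : RenewalRisk.IsRenewal θ P)
    (hind : RenewalRisk.MutuallyIndependent X θ ξ P)
    (hξ : RenewalRisk.BoundedBelow ξ θ P)
    (hA : RenewalRisk.IsRareSet A)
    (hQAI : RenewalRisk.QAIOn A X P)
    (hC : RenewalRisk.ConsistentlyVarying (RenewalRisk.lawOn F A))
    (hMRV : RenewalRisk.MRV F α μ G)
    (T : ℝ≥0) (hT : 0 < RenewalRisk.renewalFunction θ P T) :
    -- the quantities on the right-hand side are well defined, finite and (the integral) positive
    μ A < ∞ ∧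
    (∀ s ≤ T, Integrable (fun ω => Real.exp (-α * ξ s ω)) P) ∧
    IntegrableOn (fun s => ∫ ω, Real.exp (-α * ξ s ω) ∂P) (Iic T)
      (RenewalRisk.renewalMeasure θ P) ∧
    0 < ∫ s in Iic T, (∫ ω, Real.exp (-α * ξ s ω) ∂P) ∂(RenewalRisk.renewalMeasure θ P) ∧
    -- the limit relative to the tail of `G`, whether or not `μ A = 0`
    Tendsto (fun x : ℝ =>
        P.real {ω | RenewalRisk.discountedClaims X θ ξ T ω ∈ x • A} / RenewalRisk.tail G x) atTop
      (𝓝 (μ.real A *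
        ∫ s in Iic T, (∫ ω, Real.exp (-α * ξ s ω) ∂P) ∂(RenewalRisk.renewalMeasure θ P))) ∧
    -- the asymptotic equivalence
    (0 < μ A → Tendsto (fun x : ℝ =>
        P.real {ω | RenewalRisk.discountedClaims X θ ξ T ω ∈ x • A} /
          (μ.real A * RenewalRisk.tail G x *
            ∫ s in Iic T, (∫ ω, Real.exp (-α * ξ s ω) ∂P) ∂(RenewalRisk.renewalMeasure θ P)))
      atTop (𝓝 1)) := by
  obtain ⟨K, -, hK⟩ := hξ T hT
  obtain ⟨hξm, -⟩ := hind.exists_indepFun hX.measurable hθ.measurable T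
  have hα := hMRV.regularlyVarying.index_pos
  have hfin := hMRV.measure_lt_top hA
  have hpos := RenewalRisk.integral_exp_neg_mul_pos hθ hα hξm hK hT
  have hlim := RenewalRisk.tendsto_measureReal_discountedClaims hX hθ hind hA hQAI hMRV hK
  rw [integral_const_mul,
    RenewalRisk.integral_sum_discountFactor_rpow hX.measurable hθ hind hα hK] at hlim
  refine ⟨hfin, fun s hs => RenewalRisk.integrable_exp_neg_mul hα hξm hK hs,
    RenewalRisk.integrableOn_integral_exp_neg_mul hθ hα hξm hK, hpos, hlim, fun hμA => ?_⟩
  have hμ : 0 < μ.real A := ENNReal.toReal_pos hμA.ne' hfin.ne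
  have hdiv := hlim.div_const (μ.real A *
    ∫ s in Iic T, (∫ ω, Real.exp (-α * ξ s ω) ∂P) ∂(RenewalRisk.renewalMeasure θ P))
  rw [div_self (mul_pos hμ hpos).ne'] at hdiv
  refine hdiv.congr fun x => ?_
  rw [div_div]
  congr 1
  ring
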